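/- Let $E=\{1,\dots,N\}$ with $N\ge 1$, let $q\ge 1$, let $|\cdot|$ be a norm on $\mathbb{R}^d$, let $\mathcal Z\subset\mathbb{R}^d$ be a Borel set, and let $\{K_z(\cdot\mid\cdot):z\in\mathcal Z\}$ be a family of probability kernels from $E^q$ to $E$, with $z\mapsto K_z(i\mid y)$ measurable for all $i\in E$, $y\in E^q$. For $u\in[0,1]$ put $$K_z^-(u\mid y)=\inf\Big\{i\in E:\ \sum_{j=1}^iK_z(j\mid y)\ge u\Big\},\qquad \eta(z)=\min_{(i,y)\in E\times E^q}K_z(i\mid y).$$ Let $(Z_t)_{t\in\mathbb{Z}}$ be a $\mathcal Z$-valued process and $(\varepsilon_t)_{t\in\mathbb{Z}}$ a $[0,1]$-valued process on the same probability space. Assume: (C1) $\eta(z)>0$ for every $z\in\mathcal Z$. (C2) The process $((Z_t,\varepsilon_t))_{t\in\mathbb{Z}}$ is stationary and ergodic and, for every $t$, $\varepsilon_t$ is uniformly distributed on $[0,1]$ and independent of $\sigma((Z_s,\varepsilon_s):s\le t-1)$. Then the following hold. 1. There exists a stationary $E$-valued process $(Y_t)_{t\in\mathbb{Z}}$ such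 that, for every $t\in\mathbb{Z}$, almost surely, $$Y_t=K^-_{Z_{t-1}}(\varepsilon_t\mid Y_{t-1},\dots,Y_{t-q}).$$ It is unique: any other stationary solution $(Y'_t)$ satisfies $Y'_t=Y_t$ almost surely for every $t$. Moreover the process $((Y_t,Z_t))_{t\in\mathbb{Z}}$ is stationary and ergodic. 2. Assume in addition: (A4) There are random variables $(\eta_t)_{t\in\mathbb{Z}}$ with values in a measurable space $G_1$ and a measurable map $H'$ such that $Z_t=H'(\eta_t,\eta_{t-1},\dots)$ almost surely for every $t$, and the pairs $\xi_t=(\varepsilon_t,\eta_t)$, $t\in\mathbb{Z}$, are independent and identically distributed. (C3) There is a constant $C_0>0$ such that $\sum_{i=1}^N|K_z(i\mid y)-K_{z'}(i\mid y)|\le C_0|z-z'|$ for all $z,z'\in\mathcal Z$ and $y\in E^q$. Assume also that $\inf_{z\in\mathcal Z}\eta(z)>0$. Then there is a measurable map $H$ with $Y_t=H(\xi_t,\xi_{t-1},\dots)$ almost surely for every $t$, and there exist $C>0$ and $\rho\in(0,1)$ such that, for all integers $h\ge1$, $$\Theta_{1,h}(Y)\le C\Big[\rho^h+\sum_{i=1}^h\rho^i\,\Theta_{1,h-i}(Z)\Big].$$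 Here, for a process $X_t=g(\zeta_t,\zeta_{t-1},\dots)$ driven by an i.i.d. sequence $(\zeta_t)_{t\in\mathbb{Z}}$, let $\zeta_0'$ be a copy of $\zeta_0$ independent of $(\zeta_t)_{t\in\mathbb{Z}}$, let $\overline\zeta_0=\zeta_0'$ and $\overline\zeta_t=\zeta_t$ for $t\ne0$, and set $$\theta_{1,t}(X)=\mathbb{E}\,\big|g(\zeta_t,\zeta_{t-1},\dots)-g(\overline\zeta_t,\overline\zeta_{t-1},\dots)\big|\quad(t\ge 0),\qquad \Theta_{1,h}(X)=\sum_{t\ge h}\theta_{1,t}(X)\in[0,\infty].$$ For $Y$ this is applied with $\zeta=\xi$, $g=H$ (where $E\subset\mathbb{R}$), and for $Z$ with $\zeta=\eta$, $g=H'$. The bound on $\Theta_{1,h}(Y)$ holds, with the same $C$ and $\rho$, for every measurable $H$ that represents $Y$ in this way. -/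

import Mathlib

open MeasureTheory ProbabilityTheory
open scoped ENNReal

namespace CatSeries

noncomputable section

/-! ### Stationary and ergodic processes indexed by `ℤ` -/

section Processes

variable {Ω S : Type*} [MeasurableSpace Ω] [MeasurableSpace S]

/-- The time shift `(x_t)_t ↦ (x_{t+1})_t` on two-sided paths. -/
def shift (x : ℤ → S) : ℤ → S := fun t => x (t + 1)

/-- The law of the process `X` on the path space `ℤ → S` with the product σ-algebra. -/
def pathLaw (P : Measure Ω) (X : ℤ → Ω → S) : Measure (ℤ → S) :=
  P.map fun ω t => X t ω

/-- A (strictly) stationary process: a family of random variables whose path law is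
invariant under the time shift. -/
structure IsStationary (P : Measure Ω) (X : ℤ → Ω → S) : Prop where
  measurable : ∀ t, Measurable (X t)
  invariant : MeasurePreserving shift (pathLaw P X) (pathLaw P X)

/-- A stationary and ergodic process: the shift is measure preserving and ergodic
for the path law. -/
structure IsStationaryErgodic (P : Measure Ω) (X : ℤ → Ω → S) : Prop where
  measurable : ∀ t, Measurable (X t)
  ergodic : Ergodic shift (pathLaw P X)

end Processes

/-! ### The functional dependence measure -/

section Dependence

variable {Ω G S : Type*} [MeasurableSpace Ω] [MeasurableSpace G] [MeasurableSpace S]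

/-- The past `(x_t, x_{t-1}, x_{t-2}, …)` of a two-sided sequence. -/
def past (x : ℤ → G) (t : ℤ) : ℕ → G := fun j => x (t - j)

/-- `X_t = H(ξ_t, ξ_{t-1}, …)` almost surely for every `t`, with `H` measurable. -/
structure IsBernoulliShift (P : Measure Ω) (ξ : ℤ → Ω → G) (H : (ℕ → G) → S)
    (X : ℤ → Ω → S) : Prop where
  measurable : Measurable H
  eq : ∀ t, ∀ᵐ ω ∂P, X t ω = H (past (fun s => ξ s ω) t)

/-- The coefficient `θ_{1,t}` of the process `X_t = H(ξ_t, ξ_{t-1}, …)`, i.e. the expected distance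
of `H(ξ_t, ξ_{t-1}, …)` and `H(ξ̄_t, ξ̄_{t-1}, …)`, where `ξ̄` is `ξ` with `ξ_0` replaced by an
independent copy `ξ_0'`. The copy is the second coordinate of the product space `Ω × G`
with the measure `P ⊗ law(ξ_0)`. -/
def theta [EDist S] (P : Measure Ω) (ξ : ℤ → Ω → G) (H : (ℕ → G) → S) (t : ℕ) : ℝ≥0∞ :=
  ∫⁻ p : Ω × G,
    edist (H (past (fun s => ξ s p.1) t))
      (H (past (Function.update (fun s => ξ s p.1) 0 p.2) t)) ∂(P.prod (P.map (ξ 0)))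

/-- `Θ_{1,h} = ∑_{t ≥ h} θ_{1,t}`, with values in `[0,∞]`. -/
def bigTheta [EDist S] (P : Measure Ω) (ξ : ℤ → Ω → G) (H : (ℕ → G) → S) (h : ℕ) : ℝ≥0∞ :=
  ∑' k : ℕ, theta P ξ H (h + k)

end Dependence

/-! ### Categorical time series

The state space `{1,…,N}` is modelled by `Fin N`, the element `i : Fin N` standing for the
category with label `i + 1`. -/

/-- The label in `{1,…,N} ⊂ ℝ` of a category. -/
def label {N : ℕ} (i : Fin N) : ℝ := (i : ℝ) + 1

theorem quantile_nonempty {N : ℕ} (μ : Measure (Fin N)) [IsProbabilityMeasure μ]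
    (u : unitInterval) :
    (Finset.univ.filter fun i : Fin N =>
      (u : ℝ) ≤ ∑ j ∈ Finset.Iic i, μ.real {j}).Nonempty := by
  cases N with
  | zero =>
    have h : μ Set.univ = 0 := by
      rw [Set.eq_empty_of_isEmpty (Set.univ : Set (Fin 0)), measure_empty]
    rw [measure_univ] at h
    exact absurd h one_ne_zero
  | succ n =>
    refine ⟨Fin.last n, ?_⟩
    have h1 : Finset.Iic (Fin.last n) = Finset.univ := by
      ext j
      simp [Fin.le_last]
    have h2 : ∑ j : Fin (n + 1), μ.real {j} = 1 := by
      rw [sum_measureReal_singleton]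
      simp
    simp only [Finset.mem_filter, Finset.mem_univ, true_and, h1, h2]
    exact u.2.2

/-- The quantile `inf {i : ∑_{j ≤ i} μ(j) ≥ u}` of a probability `μ` on the categories. -/
def quantile {N : ℕ} (μ : Measure (Fin N)) [IsProbabilityMeasure μ] (u : unitInterval) : Fin N :=
  (Finset.univ.filter fun i : Fin N =>
    (u : ℝ) ≤ ∑ j ∈ Finset.Iic i, μ.real {j}).min' (quantile_nonempty μ u)

section Model

variable {Ω V : Type*} [MeasurableSpace Ω] [NormedAddCommGroup V] [MeasurableSpace V]
  {𝒵 : Set V} {q N : ℕ}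

/-- `η(z) = min_{(i,y)} K_z(i | y)`. -/
def minMass (K : 𝒵 → Kernel (Fin q → Fin N) (Fin N)) (z : 𝒵) : ℝ :=
  ⨅ a : Fin N × (Fin q → Fin N), (K z a.2).real {a.1}

/-- Positivity of the kernels: `η(z) > 0` for every `z`. -/
def KernelsPositive (K : 𝒵 → Kernel (Fin q → Fin N) (Fin N)) : Prop :=
  ∀ z, 0 < minMass K z

/-- `z ↦ K_z(· | y)` is Lipschitz, uniformly in `y`. -/
def KernelsLipschitz (K : 𝒵 → Kernel (Fin q → Fin N) (Fin N)) : Prop :=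
  ∃ C : ℝ, 0 < C ∧ ∀ (z z' : 𝒵) (y : Fin q → Fin N),
    ∑ i : Fin N, |(K z y).real {i} - (K z' y).real {i}| ≤ C * ‖(z : V) - (z' : V)‖

/-- `((Z_t, ε_t))_t` is stationary and ergodic, `ε_t` is uniform on `[0,1]` and independent of
`σ((Z_s, ε_s) : s ≤ t - 1)`. -/
structure CovariateNoise (P : Measure Ω) (Z : ℤ → Ω → 𝒵) (ε : ℤ → Ω → unitInterval) : Prop where
  ergodic : IsStationaryErgodic P fun t ω => (Z t ω, ε t ω)
  uniform : ∀ t, P.map (ε t) = (volume : Measure unitInterval)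
  indep : ∀ t, Indep (MeasurableSpace.comap (ε t) inferInstance)
    (⨆ s : {s : ℤ // s ≤ t - 1},
      MeasurableSpace.comap (fun ω => (Z s ω, ε s ω)) inferInstance) P

/-- `Z_t = H'(η_t, η_{t-1}, …)` with `H'` measurable, and the pairs `ξ_t = (ε_t, η_t)` are
independent and identically distributed. -/
structure ShiftCovariate {G₁ : Type*} [MeasurableSpace G₁] (P : Measure Ω) (Z : ℤ → Ω → 𝒵)
    (ε : ℤ → Ω → unitInterval) (η : ℤ → Ω → G₁) (H' : (ℕ → G₁) → 𝒵) : Prop where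
  measurable : ∀ t, Measurable (η t)
  shift : IsBernoulliShift P η H' Z
  indep : iIndepFun (fun t ω => (ε t ω, η t ω)) P
  identDistrib : ∀ t, IdentDistrib (fun ω => (ε t ω, η t ω)) (fun ω => (ε 0 ω, η 0 ω)) P P

/-- For every `t`, almost surely,
`Y_t = inf {i : ∑_{j ≤ i} K_{Z_{t-1}}(j | Y_{t-1}, …, Y_{t-q}) ≥ ε_t}`. -/
def IsSolution (P : Measure Ω) (K : 𝒵 → Kernel (Fin q → Fin N) (Fin N))
    [∀ z, IsMarkovKernel (K z)] (Z : ℤ → Ω → 𝒵) (ε : ℤ → Ω → unitInterval)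
    (Y : ℤ → Ω → Fin N) : Prop :=
  ∀ t, ∀ᵐ ω ∂P,
    Y t ω = quantile (K (Z (t - 1) ω) fun j : Fin q => Y (t - 1 - (j : ℕ)) ω) (ε t ω)

end Model

end

end CatSeries

open CatSeries

open MeasureTheory ProbabilityTheory Filter

namespace CatSeries

noncomputable section

/-! ### Quantiles -/

/-! If `ε_t` is at most the minimal mass of `K_{Z_{t-1}}`, the quantile is the first category
whatever the previous states are. When this happens at `q` consecutive times the recursion forgets
its past: the path regenerates. Positivity of the kernels and independence of the noise from the
past give regeneration positive probability, and ergodicity makes almost every path regenerate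
arbitrarily early (`ae_mem_recurrentPaths`). Along such a path the iterates of the recursion settle
at every time on a value that does not depend on where they start, so there is exactly one solution
(`sweep_solution`, `eq_solution`). It is a measurable map of the path that commutes with the shift,
and therefore inherits stationarity and ergodicity.

For the bound, run the recursion along the original innovations and along those resampled at time
`0`. Let `p t` be the probability that the two solutions differ somewhere in `(t - q, t]`, and let
`κ` be a uniform lower bound of the masses. During the next `q` steps the noise stays below `κ` with
probability `κ ^ q`, independently of the past, and then both solutions are in the first category.
Otherwise agreement persists unless the two covariates yield different quantiles, which by the
Lipschitz condition has probability at most a multiple of their expected distance. Hence `p (t + q)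
≤ (1 - κ ^ q) * p t + A * ∑ r < q, θ (t + r)` with `θ` the coefficients of `Z`
(`measure_exists_solution_ne_le`). Iterating (`le_of_contractive_recursion`) and summing over `t ≥
h` (`tsum_geometric_convolution_le`) gives the claim, because labels are at distance at most `N`. -/

theorem quantile_le_iff {N : ℕ} (μ : Measure (Fin N)) [IsProbabilityMeasure μ]
    (u : unitInterval) (i : Fin N) :
    quantile μ u ≤ i ↔ (u : ℝ) ≤ ∑ j ∈ Finset.Iic i, μ.real {j} := by
  constructor
  · intro h
    have h1 := Finset.min'_mem _ (quantile_nonempty μ u)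
    rw [Finset.mem_filter] at h1
    exact h1.2.trans (Finset.sum_le_sum_of_subset_of_nonneg (Finset.Iic_subset_Iic.2 h)
      fun _ _ _ => measureReal_nonneg)
  · intro h
    exact Finset.min'_le _ _ (by simpa using h)

/-- Two quantiles that differ are separated by a value of one of the distribution functions. -/
theorem exists_mem_uIoc_of_quantile_ne {N : ℕ} (μ ν : Measure (Fin N)) [IsProbabilityMeasure μ]
    [IsProbabilityMeasure ν] (u : unitInterval) (h : quantile μ u ≠ quantile ν u) :
    ∃ i : Fin N, (u : ℝ) ∈ Set.uIoc (∑ j ∈ Finset.Iic i, μ.real {j})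
      (∑ j ∈ Finset.Iic i, ν.real {j}) := by
  by_contra! hc
  apply h
  refine eq_of_forall_ge_iff fun i => ?_
  rw [quantile_le_iff, quantile_le_iff]
  have := hc i
  rw [Set.mem_uIoc] at this
  push Not at this
  constructor
  · intro h1
    by_contra! h2
    exact absurd h1 (not_le.2 (this.2 h2))
  · intro h1
    by_contra! h2
    exact absurd h1 (not_le.2 (this.1 h2))

/-! ### Regeneration and the pathwise solution. -/

section Paths

variable {V : Type*} {𝒵 : Set V} {q N : ℕ} (K : 𝒵 → Kernel (Fin q → Fin N) (Fin N))

theorem minMass_nonneg (z : 𝒵) : 0 ≤ minMass K z :=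
  Real.iInf_nonneg fun _ => measureReal_nonneg

theorem minMass_le (z : 𝒵) (i : Fin N) (y : Fin q → Fin N) :
    minMass K z ≤ (K z y).real {i} :=
  ciInf_le (Set.finite_range _).bddBelow (i, y)

/-- The path `x` regenerates at time `s`: the recursion is in the first category on the time
interval `(s - q, s]`, whatever happened before. -/
def Regenerates (x : ℤ → 𝒵 × unitInterval) (s : ℤ) : Prop :=
  ∀ r, s - q < r → r ≤ s → ((x r).2 : ℝ) ≤ minMass K (x (r - 1)).1

/-- The paths that regenerate at arbitrarily early times. -/
def recurrentPaths : Set (ℤ → 𝒵 × unitInterval) := {x | ∀ m : ℤ, ∃ s ≤ m, Regenerates K x s}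

variable [∀ z, IsMarkovKernel (K z)]

/-- One sweep of the recursion along the whole path `x = (z_t, u_t)_t`: the fixed points of
`sweep K x` are the solutions along `x`. -/
def sweep (x : ℤ → 𝒵 × unitInterval) (y : ℤ → Fin N) : ℤ → Fin N := fun t =>
  quantile (K (x (t - 1)).1 fun j : Fin q => y (t - 1 - (j : ℕ))) (x t).2

variable [NeZero N]

/-- The minimal mass is at most the mass of the first category, which is the first value of the
distribution function for every `y`. -/
theorem quantile_eq_zero (z : 𝒵) (y : Fin q → Fin N) (u : unitInterval)
    (h : (u : ℝ) ≤ minMass K z) : quantile (K z y) u = 0 := by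
  have h0 : quantile (K z y) u ≤ 0 := by
    rw [quantile_le_iff]
    refine h.trans ((minMass_le K z 0 y).trans ?_)
    exact Finset.single_le_sum (f := fun j => (K z y).real {j}) (fun _ _ => measureReal_nonneg)
      (by simp)
  exact le_antisymm h0 (Fin.zero_le _)

variable {K} in
-- One sweep fixes the values on `(s - q, s]`. Each further sweep extends the agreement by one time
-- to the right, since a value reads only the `q` preceding ones and these already lie in the window
-- of agreement.
theorem Regenerates.iterate_eq {x : ℤ → 𝒵 × unitInterval} {s : ℤ} (h : Regenerates K x s)
    (y y' : ℤ → Fin N) (n : ℕ) :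
    ∀ t, s - q < t → t ≤ s + n → ((sweep K x)^[n + 1] y) t = ((sweep K x)^[n + 1] y') t := by
  have key : ∀ (a a' : ℤ → Fin N) (t : ℤ), s - q < t → t ≤ s → sweep K x a t = sweep K x a' t := by
    intro a a' t h1 h2
    simp only [sweep]
    rw [quantile_eq_zero K _ _ _ (h t h1 h2), quantile_eq_zero K _ _ _ (h t h1 h2)]
  induction n with
  | zero =>
    intro t h1 h2
    exact key y y' t h1 (by simpa using h2)
  | succ n ih =>
    intro t h1 h2
    rw [Function.iterate_succ_apply', Function.iterate_succ_apply' (sweep K x) (n + 1)]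
    by_cases hts : t ≤ s
    · exact key _ _ t h1 hts
    · simp only [sweep]
      congr 2
      funext j
      have := j.2
      apply ih
      · omega
      · push_cast at h2 ⊢; omega

/-- The solution along the path `x`, as the limit of the sweeps. -/
def solution (x : ℤ → 𝒵 × unitInterval) : ℤ → Fin N := fun t =>
  limsup (fun n : ℕ => ((sweep K x)^[n] fun _ => 0) t) atTop

variable {K}

theorem eventually_iterate_eq {x : ℤ → 𝒵 × unitInterval} (hx : x ∈ recurrentPaths K) (t : ℤ) :
    ∃ n₀ : ℕ, ∀ n ≥ n₀, ∀ y y' : ℤ → Fin N, ((sweep K x)^[n] y) t = ((sweep K x)^[n] y') t := by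
  obtain ⟨s, hs, h⟩ := hx (t - 1)
  by_cases hq : s - q < t
  · refine ⟨(t - s).toNat + 1, fun n hn y y' => ?_⟩
    obtain ⟨k, rfl⟩ : ∃ k, n = k + 1 := ⟨n - 1, by omega⟩
    exact h.iterate_eq y y' k t hq (by omega)
  · omega

theorem eventually_iterate_eq_solution {x : ℤ → 𝒵 × unitInterval} (hx : x ∈ recurrentPaths K)
    (t : ℤ) : ∀ᶠ n : ℕ in atTop, ∀ y, ((sweep K x)^[n] y) t = solution K x t := by
  obtain ⟨n₀, h⟩ := eventually_iterate_eq hx t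
  have hc : ∀ n ≥ n₀, ((sweep K x)^[n] fun _ => 0) t = ((sweep K x)^[n₀] fun _ => 0) t := by
    intro n hn
    induction n, hn using Nat.le_induction with
    | base => rfl
    | succ n hn ih =>
      -- `n + 1` sweeps from `0` are `n` sweeps from another starting sequence, and from `n₀` on the
      -- start is irrelevant.
      rw [← ih, Function.iterate_succ_apply]
      exact h n hn _ _
  have hs : solution K x t = ((sweep K x)^[n₀] fun _ => 0) t := by
    have : solution K x t = limsup (fun _ : ℕ => ((sweep K x)^[n₀] fun _ => 0) t) atTop :=
      limsup_congr (eventually_atTop.2 ⟨n₀, hc⟩)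
    rw [this, limsup_const]
  filter_upwards [eventually_ge_atTop n₀] with n hn y
  rw [hs, ← hc n hn]
  exact h n hn _ _

/-- A value of a sweep reads finitely many coordinates, so a single `n` serves at which all of them,
and the value itself one sweep later, have reached the limit. -/
theorem sweep_solution {x : ℤ → 𝒵 × unitInterval} (hx : x ∈ recurrentPaths K) :
    sweep K x (solution K x) = solution K x := by
  funext t
  have h1 := eventually_iterate_eq_solution hx t
  have h2 : ∀ᶠ n : ℕ in atTop, ∀ j : Fin q, ∀ y,
      ((sweep K x)^[n] y) (t - 1 - (j : ℕ)) = solution K x (t - 1 - (j : ℕ)) :=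
    eventually_all.2 fun j => eventually_iterate_eq_solution hx _
  obtain ⟨n, hn1, hn2⟩ := (((tendsto_add_atTop_nat 1).eventually h1).and h2).exists
  rw [← hn1 fun _ => 0, Function.iterate_succ_apply']
  simp only [sweep]
  congr 2
  funext j
  exact (hn2 j _).symm

theorem eq_solution {x : ℤ → 𝒵 × unitInterval} (hx : x ∈ recurrentPaths K) {y : ℤ → Fin N}
    (hy : sweep K x y = y) : y = solution K x := by
  funext t
  obtain ⟨n, hn⟩ := (eventually_iterate_eq_solution hx t).exists
  rw [← hn y, Function.iterate_fixed hy]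

variable (K)

/-- The constant starting sequence is translation invariant, and a sweep commutes with translations.
-/
theorem solution_translate (x : ℤ → 𝒵 × unitInterval) (m : ℤ) (t : ℤ) :
    solution K (fun s => x (s + m)) t = solution K x (t + m) := by
  have h : ∀ n : ℕ, ∀ t, ((sweep K fun s => x (s + m))^[n] fun _ => 0) t
      = ((sweep K x)^[n] fun _ => 0) (t + m) := by
    intro n
    induction n with
    | zero => intro t; rfl
    | succ n ih =>
      intro t
      rw [Function.iterate_succ_apply', Function.iterate_succ_apply']
      simp only [sweep, ih]
      have e : t - 1 + m = t + m - 1 := by ring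
      have e' : ∀ j : Fin q, t - 1 - ((j : ℕ) : ℤ) + m = t + m - 1 - ((j : ℕ) : ℤ) := by
        intro j; ring
      simp only [e, e']
  simp only [solution, h]

theorem solution_shift (x : ℤ → 𝒵 × unitInterval) :
    solution K (shift x) = shift (solution K x) :=
  funext fun t => solution_translate K x 1 t

/-- Causality of the solution. -/
theorem solution_congr {x x' : ℤ → 𝒵 × unitInterval} {t : ℤ} (h : ∀ s ≤ t, x s = x' s) :
    solution K x t = solution K x' t := by
  have key : ∀ n : ℕ, ∀ s ≤ t, ((sweep K x)^[n] fun _ => 0) s = ((sweep K x')^[n] fun _ => 0) s := by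
    intro n
    induction n with
    | zero => intro s _; rfl
    | succ n ih =>
      intro s hs
      rw [Function.iterate_succ_apply', Function.iterate_succ_apply']
      simp only [sweep]
      have e : (fun j : Fin q => ((sweep K x)^[n] fun _ => 0) (s - 1 - ((j : ℕ) : ℤ)))
          = fun j : Fin q => ((sweep K x')^[n] fun _ => 0) (s - 1 - ((j : ℕ) : ℤ)) :=
        funext fun j => ih _ (by omega)
      simp only [h s hs, h (s - 1) (by omega), e]
  simp only [solution, key _ t le_rfl]

end Paths

/-! ### Measurability -/

section Measurability

variable {V : Type*} [MeasurableSpace V] {𝒵 : Set V} {q N : ℕ}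
  {K : 𝒵 → Kernel (Fin q → Fin N) (Fin N)}

theorem measurable_minMass (hK : ∀ (y : Fin q → Fin N) (i : Fin N), Measurable fun z => K z y {i}) :
    Measurable (minMass K) :=
  Measurable.iInf fun a => (hK a.2 a.1).ennreal_toReal

theorem measurableSet_regenerates
    (hK : ∀ (y : Fin q → Fin N) (i : Fin N), Measurable fun z => K z y {i}) (s : ℤ) :
    MeasurableSet {x : ℤ → 𝒵 × unitInterval | Regenerates K x s} := by
  simp only [Regenerates, Set.ofPred_forall]
  refine MeasurableSet.iInter fun r => MeasurableSet.iInter fun _ => MeasurableSet.iInter fun _ => ?_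
  exact measurableSet_le
    (measurable_subtype_coe.comp (measurable_snd.comp (measurable_pi_apply r)))
    ((measurable_minMass hK).comp (measurable_fst.comp (measurable_pi_apply (r - 1))))

theorem measurableSet_recurrentPaths
    (hK : ∀ (y : Fin q → Fin N) (i : Fin N), Measurable fun z => K z y {i}) :
    MeasurableSet (recurrentPaths K) := by
  have e : recurrentPaths K = ⋂ m : ℤ, ⋃ s : ℤ, ⋃ _ : s ≤ m, {x | Regenerates K x s} := by
    ext x
    simp [recurrentPaths]
  rw [e]
  exact MeasurableSet.iInter fun m => MeasurableSet.iUnion fun s => MeasurableSet.iUnion fun _ =>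
    measurableSet_regenerates hK s

variable [∀ z, IsMarkovKernel (K z)]

theorem measurable_quantile {α : Type*} [MeasurableSpace α]
    (hK : ∀ (y : Fin q → Fin N) (i : Fin N), Measurable fun z => K z y {i})
    {z : α → 𝒵} {u : α → unitInterval} {y : α → Fin q → Fin N} (hz : Measurable z)
    (hu : Measurable u) (hy : Measurable y) :
    Measurable fun a => quantile (K (z a) (y a)) (u a) := by
  refine measurable_to_countable' fun i => ?_
  have hF : ∀ i : Fin N, MeasurableSet {a | quantile (K (z a) (y a)) (u a) ≤ i} := by
    intro i
    simp only [quantile_le_iff]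
    refine measurableSet_le (measurable_subtype_coe.comp hu)
      (Finset.measurable_sum _ fun j _ => ?_)
    -- There are finitely many `y`, so measurability in `z` for each fixed `y` gives joint
    -- measurability.
    have h : Measurable fun p : 𝒵 × (Fin q → Fin N) => (K p.1 p.2).real {j} :=
      measurable_from_prod_countable_left fun y => (hK y j).ennreal_toReal
    exact h.comp (hz.prodMk hy)
  have e : (fun a => quantile (K (z a) (y a)) (u a)) ⁻¹' {i}
      = {a | quantile (K (z a) (y a)) (u a) ≤ i} \
        ⋃ j : Fin N, ⋃ _ : j < i, {a | quantile (K (z a) (y a)) (u a) ≤ j} := by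
    ext a
    simp only [Set.mem_preimage, Set.mem_singleton_iff, Set.mem_sdiff, Set.mem_ofPred_eq,
      Set.mem_iUnion, not_exists, not_le]
    constructor
    · rintro h
      exact ⟨h.le, fun j hj => h ▸ hj⟩
    · rintro ⟨h1, h2⟩
      refine h1.antisymm (not_lt.1 fun h3 => lt_irrefl _ (h2 _ h3))
  rw [e]
  exact (hF i).diff (MeasurableSet.iUnion fun j => MeasurableSet.iUnion fun _ => hF j)

variable [NeZero N]

theorem measurable_iterate_sweep
    (hK : ∀ (y : Fin q → Fin N) (i : Fin N), Measurable fun z => K z y {i}) (n : ℕ) :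
    Measurable fun x : ℤ → 𝒵 × unitInterval => (sweep K x)^[n] fun _ => 0 := by
  induction n with
  | zero => exact measurable_const
  | succ n ih =>
    refine measurable_pi_lambda _ fun t => ?_
    have hy : Measurable fun x : ℤ → 𝒵 × unitInterval =>
        fun j : Fin q => ((sweep K x)^[n] fun _ => 0) (t - 1 - (j : ℕ)) :=
      measurable_pi_lambda _ fun j => (measurable_pi_apply _).comp ih
    have h := measurable_quantile hK (measurable_fst.comp (measurable_pi_apply (t - 1)))
      (measurable_snd.comp (measurable_pi_apply t)) hy
    have e : (fun x : ℤ → 𝒵 × unitInterval => ((sweep K x)^[n + 1] fun _ => 0) t)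
        = fun x => sweep K x ((sweep K x)^[n] fun _ => 0) t := by
      funext x
      rw [Function.iterate_succ_apply']
    rw [e]
    exact h

/-- A limsup of measurable maps is measurable on the whole path space, so the paths on which the
sweeps fail to converge need no separate treatment. -/
theorem measurable_solution
    (hK : ∀ (y : Fin q → Fin N) (i : Fin N), Measurable fun z => K z y {i}) :
    Measurable (solution K) :=
  measurable_pi_lambda _ fun t => Measurable.limsup fun n =>
    (measurable_pi_apply t).comp (measurable_iterate_sweep hK n)

end Measurability

/-! ### Factors of stationary ergodic processes -/

section Factors

variable {Ω S S' : Type*} [MeasurableSpace Ω] [MeasurableSpace S] [MeasurableSpace S']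
  {P : Measure Ω}

theorem measurable_shift : Measurable (shift : (ℤ → S) → ℤ → S) :=
  measurable_pi_lambda _ fun t => measurable_pi_apply (t + 1)

theorem IsStationaryErgodic.isStationary {X : ℤ → Ω → S} (h : IsStationaryErgodic P X) :
    IsStationary P X :=
  ⟨h.measurable, h.ergodic.toMeasurePreserving⟩

/-- A measurable image of a stationary ergodic process under a map commuting with the shift is
stationary and ergodic. -/
theorem IsStationaryErgodic.factor {X : ℤ → Ω → S} (h : IsStationaryErgodic P X)
    {F : (ℤ → S) → ℤ → S'} (hF : Measurable F) (hs : ∀ x, F (shift x) = shift (F x)) :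
    IsStationaryErgodic P fun t ω => F (fun s => X s ω) t := by
  have hX : Measurable fun ω => fun s => X s ω := measurable_pi_lambda _ h.measurable
  have hlaw : pathLaw P (fun t ω => F (fun s => X s ω) t) = (pathLaw P X).map F :=
    (Measure.map_map hF hX).symm
  refine ⟨fun t => (measurable_pi_apply t).comp (hF.comp hX), ?_⟩
  rw [hlaw]
  exact (hF.measurePreserving (pathLaw P X)).ergodic_of_ergodic_semiconj h.ergodic
    measurable_shift hs

end Factors

/-! ### Uniform noise independent of the past -/

theorem volume_unitInterval_le (c : ℝ) (h0 : 0 ≤ c) (h1 : c ≤ 1) :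
    (volume : Measure unitInterval) {u | (u : ℝ) ≤ c} = ENNReal.ofReal c :=
  unitInterval.volume_Iic ⟨c, h0, h1⟩

theorem measure_inter_le_of_indep {Ω : Type*} {m m0 : MeasurableSpace Ω} {P : Measure Ω}
    {ε : Ω → unitInterval} (hε : Measurable ε)
    (hu : P.map ε = volume) (hi : Indep (MeasurableSpace.comap ε inferInstance) m P)
    {B : Set Ω} (hB : MeasurableSet[m] B) {c : ℝ} (h0 : 0 ≤ c) (h1 : c ≤ 1) :
    P (B ∩ {ω | (ε ω : ℝ) ≤ c}) = P B * ENNReal.ofReal c := by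
  have hs : MeasurableSet {u : unitInterval | (u : ℝ) ≤ c} :=
    measurableSet_le measurable_subtype_coe measurable_const
  have h := (Indep_iff _ _ _).1 hi (ε ⁻¹' {u | (u : ℝ) ≤ c}) B ⟨_, hs, rfl⟩ hB
  rw [Set.inter_comm]
  change P (ε ⁻¹' {u | (u : ℝ) ≤ c} ∩ B) = _
  rw [h, ← Measure.map_apply hε hs, hu, volume_unitInterval_le c h0 h1, mul_comm]

/-! ### Recurrence of regeneration -/

section Recurrence

variable {Ω V : Type*} [MeasurableSpace Ω] {P : Measure Ω}
  [MeasurableSpace V] {𝒵 : Set V} {q N : ℕ} {K : 𝒵 → Kernel (Fin q → Fin N) (Fin N)}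
  {Z : ℤ → Ω → 𝒵} {ε : ℤ → Ω → unitInterval}

theorem CovariateNoise.measurable_path (h : CovariateNoise P Z ε) :
    Measurable fun ω => fun t => (Z t ω, ε t ω) :=
  measurable_pi_lambda _ h.ergodic.measurable

/-- Induction on the number of steps. The threshold `minMass K (Z k ω)` is random and need not be
bounded away from `0`, but it is determined by the past and positive, so it exceeds some fixed `1 /
(n + 1)` on a part of the previous event of positive probability. The next noise variable is
independent of that part and lies below `1 / (n + 1)` with positive probability. -/
theorem measure_pos_of_kernelsPositive [IsProbabilityMeasure P]
    (hK : ∀ (y : Fin q → Fin N) (i : Fin N), Measurable fun z => K z y {i})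
    (hC1 : KernelsPositive K) (hC2 : CovariateNoise P Z ε) (k : ℕ) :
    0 < P {ω | ∀ r : ℤ, 0 < r → r ≤ k → (ε r ω : ℝ) ≤ minMass K (Z (r - 1) ω)} := by
  have hmeas : ∀ s t : ℤ, s ≤ t →
      Measurable[⨆ s : {s : ℤ // s ≤ t},
        MeasurableSpace.comap (fun ω => (Z s ω, ε s ω)) inferInstance]
        fun ω => (Z s ω, ε s ω) := by
    intro s t hst
    refine Measurable.mono (comap_measurable (fun ω => (Z s ω, ε s ω))) ?_ le_rfl
    exact le_iSup (fun s : {s : ℤ // s ≤ t} =>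
        MeasurableSpace.comap (fun ω => (Z s ω, ε s ω)) inferInstance) ⟨s, hst⟩
  induction k with
  | zero =>
    have : {ω | ∀ r : ℤ, 0 < r → r ≤ (0 : ℕ) → (ε r ω : ℝ) ≤ minMass K (Z (r - 1) ω)}
        = Set.univ := by
      ext ω
      simp only [Set.mem_ofPred_eq, Set.mem_univ, iff_true]
      intro r h1 h2
      exact absurd h1 (by simpa using h2)
    rw [this]
    simp
  | succ k ih =>
    set B := {ω | ∀ r : ℤ, 0 < r → r ≤ k → (ε r ω : ℝ) ≤ minMass K (Z (r - 1) ω)} with hB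
    have hU : B = ⋃ n : ℕ, B ∩ {ω | 1 / ((n : ℝ) + 1) ≤ minMass K (Z k ω)} := by
      rw [← Set.inter_iUnion]
      refine (Set.inter_eq_left.2 fun ω _ => ?_).symm
      obtain ⟨n, hn⟩ := exists_nat_one_div_lt (hC1 (Z k ω))
      exact Set.mem_iUnion.2 ⟨n, hn.le⟩
    obtain ⟨n, hn⟩ : ∃ n : ℕ, 0 < P (B ∩ {ω | 1 / ((n : ℝ) + 1) ≤ minMass K (Z k ω)}) := by
      by_contra! hc
      refine ih.ne' ?_
      rw [hU]
      exact measure_iUnion_null fun n => nonpos_iff_eq_zero.1 (hc n)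
    have hc0 : 0 < 1 / ((n : ℝ) + 1) := by positivity
    have hc1 : 1 / ((n : ℝ) + 1) ≤ 1 := by
      rw [div_le_one (by positivity)]
      linarith [Nat.cast_nonneg (α := ℝ) n]
    have hBm : MeasurableSet[⨆ s : {s : ℤ // s ≤ ((k : ℤ) + 1) - 1},
        MeasurableSpace.comap (fun ω => (Z s ω, ε s ω)) inferInstance]
        (B ∩ {ω | 1 / ((n : ℝ) + 1) ≤ minMass K (Z k ω)}) := by
      refine MeasurableSet.inter ?_ ?_
      · simp only [hB, Set.ofPred_forall]
        refine MeasurableSet.iInter fun r => MeasurableSet.iInter fun h1 =>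
          MeasurableSet.iInter fun h2 => ?_
        exact measurableSet_le
          (measurable_subtype_coe.comp (measurable_snd.comp (hmeas r _ (by omega))))
          ((measurable_minMass hK).comp (measurable_fst.comp (hmeas (r - 1) _ (by omega))))
      · exact measurableSet_le measurable_const
          ((measurable_minMass hK).comp (measurable_fst.comp (hmeas k _ (by omega))))
    have h := measure_inter_le_of_indep (ε := ε ((k : ℤ) + 1))
      (measurable_snd.comp (hC2.ergodic.measurable ((k : ℤ) + 1))) (hC2.uniform _)
      (hC2.indep ((k : ℤ) + 1)) hBm hc0.le hc1
    refine lt_of_lt_of_le ?_ (measure_mono (?_ : (B ∩ {ω | 1 / ((n : ℝ) + 1) ≤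
      minMass K (Z k ω)}) ∩ {ω | (ε ((k : ℤ) + 1) ω : ℝ) ≤ 1 / ((n : ℝ) + 1)} ⊆ _))
    · rw [h]
      exact ENNReal.mul_pos hn.ne' (ENNReal.ofReal_pos.2 hc0).ne'
    · rintro ω ⟨⟨h1, h2⟩, h3⟩ r hr0 hr
      rcases lt_or_ge (k : ℤ) r with hkr | hkr
      · obtain rfl : r = k + 1 := by push_cast at hr; omega
        rw [add_sub_cancel_right]
        exact le_trans h3 h2
      · exact h1 r hr0 hkr

/-- By stationarity, regeneration at time `s` has the same positive probability for every `s`. The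
event of arbitrarily early regeneration is a decreasing limit of events that are at least as likely,
so it has positive probability. It is shift invariant, so ergodicity makes it almost sure. -/
theorem ae_mem_recurrentPaths [IsProbabilityMeasure P]
    (hK : ∀ (y : Fin q → Fin N) (i : Fin N), Measurable fun z => K z y {i})
    (hC1 : KernelsPositive K) (hC2 : CovariateNoise P Z ε) :
    ∀ᵐ ω ∂P, (fun t => (Z t ω, ε t ω)) ∈ recurrentPaths K := by
  have hX := hC2.measurable_path
  have herg := hC2.ergodic.ergodic
  set μ := pathLaw P fun t ω => (Z t ω, ε t ω) with hμ
  have : IsProbabilityMeasure μ := Measure.isProbabilityMeasure_map hX.aemeasurable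
  have hR := fun s => measurableSet_regenerates hK s
  have hshift : ∀ (x : ℤ → 𝒵 × unitInterval) (s : ℤ),
      Regenerates K (shift x) s ↔ Regenerates K x (s + 1) := by
    intro x s
    constructor
    · intro h r h1 h2
      have := h (r - 1) (by omega) (by omega)
      simpa only [shift, sub_add_cancel] using this
    · intro h r h1 h2
      have := h (r + 1) (by omega) (by omega)
      have e : r + 1 - 1 = r - 1 + 1 := by ring
      rw [e] at this
      exact this
  have hinv : shift ⁻¹' recurrentPaths K = recurrentPaths K := by
    ext x
    simp only [recurrentPaths, Set.mem_preimage, Set.mem_ofPred_eq, hshift]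
    constructor
    · intro h m
      obtain ⟨s, hs, h⟩ := h (m - 1)
      exact ⟨s + 1, by omega, h⟩
    · intro h m
      obtain ⟨s, hs, h⟩ := h (m + 1)
      exact ⟨s - 1, by omega, by simpa using h⟩
  -- A countable decreasing intersection, for continuity from above. The bound `q - n` starts at `q`
  -- because regeneration at `q` concerns the noise at the times `1, …, q`.
  have hGe : recurrentPaths K = ⋂ n : ℕ, ⋃ s : ℤ, ⋃ _ : s ≤ q - n, {x | Regenerates K x s} := by
    ext x
    simp only [recurrentPaths, Set.mem_ofPred_eq, Set.mem_iInter, Set.mem_iUnion, exists_prop]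
    constructor
    · intro h n
      exact h _
    · intro h m
      obtain ⟨s, hs, h⟩ := h (q - m).toNat
      exact ⟨s, by omega, h⟩
  have hUm : ∀ n : ℕ, MeasurableSet (⋃ s : ℤ, ⋃ _ : s ≤ (q : ℤ) - n, {x | Regenerates K x s}) :=
    fun n => MeasurableSet.iUnion fun s => MeasurableSet.iUnion fun _ => hR s
  have hconst : ∀ n : ℕ, μ {x | Regenerates K x (q - n)} = μ {x | Regenerates K x q} := by
    intro n
    induction n with
    | zero => simp
    | succ n ih =>
      rw [← ih, ← herg.toMeasurePreserving.measure_preimage (hR _).nullMeasurableSet]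
      congr 1
      ext x
      simp only [Set.mem_preimage, Set.mem_ofPred_eq, hshift]
      rw [show (q : ℤ) - ((n + 1 : ℕ) : ℤ) + 1 = q - n by push_cast; ring]
  have hpos : 0 < μ {x | Regenerates K x q} := by
    rw [hμ, pathLaw, Measure.map_apply hX (hR _)]
    have := measure_pos_of_kernelsPositive hK hC1 hC2 q
    simpa only [Regenerates, sub_self, Set.preimage_ofPred_eq] using this
  have hG : 0 < μ (recurrentPaths K) := by
    rw [hGe, Antitone.measure_iInter _ (fun n => (hUm n).nullMeasurableSet)
      ⟨0, measure_ne_top _ _⟩]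
    · refine hpos.trans_le (le_iInf fun n => ?_)
      rw [← hconst n]
      exact measure_mono (Set.subset_iUnion₂_of_subset _ le_rfl subset_rfl)
    · intro m n hmn
      refine Set.iUnion_mono fun s => Set.iUnion_mono' fun hs => ⟨by omega, subset_rfl⟩
  have h1 : μ (recurrentPaths K) = 1 :=
    (herg.toPreErgodic.prob_eq_zero_or_one (measurableSet_recurrentPaths hK) hinv).resolve_left hG.ne'
  have h2 : ∀ᵐ x ∂μ, x ∈ recurrentPaths K := (prob_compl_eq_zero_iff (measurableSet_recurrentPaths hK)).2 h1
  exact ae_of_ae_map hX.aemeasurable h2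

end Recurrence

/-! ### Existence, uniqueness and ergodicity of the stationary solution. -/

section Solutions

variable {Ω V : Type*} [MeasurableSpace Ω] {P : Measure Ω}
  {𝒵 : Set V} {q N : ℕ} [NeZero N]
  {K : 𝒵 → Kernel (Fin q → Fin N) (Fin N)} [∀ z, IsMarkovKernel (K z)]
  {Z : ℤ → Ω → 𝒵} {ε : ℤ → Ω → unitInterval}

theorem IsSolution.ae_eq_solution
    (hG : ∀ᵐ ω ∂P, (fun t => (Z t ω, ε t ω)) ∈ recurrentPaths K) {Y : ℤ → Ω → Fin N}
    (hY : IsSolution P K Z ε Y) :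
    ∀ᵐ ω ∂P, (fun t => Y t ω) = solution K fun t => (Z t ω, ε t ω) := by
  filter_upwards [hG, ae_all_iff.2 hY] with ω h1 h2
  exact eq_solution h1 (funext fun t => (h2 t).symm)

theorem isSolution_solution
    (hG : ∀ᵐ ω ∂P, (fun t => (Z t ω, ε t ω)) ∈ recurrentPaths K) :
    IsSolution P K Z ε fun t ω => solution K (fun s => (Z s ω, ε s ω)) t := by
  intro t
  filter_upwards [hG] with ω h
  exact (congrFun (sweep_solution h) t).symm

theorem exists_unique_stationary_solution [MeasurableSpace V] [IsProbabilityMeasure P]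
    (hK : ∀ (y : Fin q → Fin N) (i : Fin N), Measurable fun z => K z y {i})
    (hC1 : KernelsPositive K) (hC2 : CovariateNoise P Z ε) :
    ∃ Y : ℤ → Ω → Fin N,
      IsStationary P Y ∧ IsSolution P K Z ε Y ∧
      IsStationaryErgodic P (fun t ω => (Y t ω, Z t ω)) ∧
      ∀ Y' : ℤ → Ω → Fin N, IsStationary P Y' → IsSolution P K Z ε Y' →
        ∀ t, Y' t =ᵐ[P] Y t := by
  have hG := ae_mem_recurrentPaths hK hC1 hC2
  have hS := measurable_solution hK
  refine ⟨fun t ω => solution K (fun s => (Z s ω, ε s ω)) t, ?_, isSolution_solution hG, ?_, ?_⟩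
  · exact (hC2.ergodic.factor hS (solution_shift K)).isStationary
  · refine hC2.ergodic.factor (F := fun x t => (solution K x t, (x t).1)) ?_ ?_
    · exact measurable_pi_lambda _ fun t => ((measurable_pi_apply t).comp hS).prodMk
        (measurable_fst.comp (measurable_pi_apply t))
    · intro x
      funext t
      simp only [solution_shift]
      rfl
  · intro Y' _ hY' t
    filter_upwards [hY'.ae_eq_solution hG] with ω h
    exact congrFun h t

end Solutions

/-! ### Recursive inequalities in `[0,∞]` -/

/-- Induction in steps of `q`. The condition `1 ≤ c * ρ ^ q` covers the initial times `t < q`, where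
only `p t ≤ 1` is known; `C ≤ c * ρ ^ q` lets the `q` newest terms, whose weights `ρ ^ (q - r)` are
at least `ρ ^ q`, absorb the constant `C`. -/
theorem le_of_contractive_recursion {p θ : ℕ → ℝ≥0∞} {q : ℕ} (hq : 1 ≤ q) {ρ C c : ℝ≥0∞}
    (hρ : ρ ≤ 1) (hp : ∀ t, p t ≤ 1)
    (hrec : ∀ t, p (t + q) ≤ ρ ^ q * p t + C * ∑ r ∈ Finset.range q, θ (t + r))
    (hc1 : 1 ≤ c * ρ ^ q) (hcC : C ≤ c * ρ ^ q) (t : ℕ) :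
    p t ≤ c * (ρ ^ t + ∑ s ∈ Finset.range t, ρ ^ (t - s) * θ s) := by
  induction t using Nat.strong_induction_on with
  | _ t ih =>
    rcases lt_or_ge t q with htq | htq
    · calc p t ≤ 1 := hp t
        _ ≤ c * ρ ^ q := hc1
        _ ≤ c * ρ ^ t := mul_le_mul_right (pow_le_pow_right_of_le_one' hρ htq.le) c
        _ ≤ _ := mul_le_mul_right le_self_add c
    · obtain ⟨t, rfl⟩ : ∃ k, t = k + q := ⟨t - q, by omega⟩
      have h1 := ih t (by omega)
      have h2 : ρ ^ q * p t
          ≤ c * (ρ ^ (t + q) + ∑ s ∈ Finset.range t, ρ ^ (t + q - s) * θ s) := by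
        calc ρ ^ q * p t
            ≤ ρ ^ q * (c * (ρ ^ t + ∑ s ∈ Finset.range t, ρ ^ (t - s) * θ s)) :=
              mul_le_mul_right h1 _
          _ = c * (ρ ^ (t + q) + ∑ s ∈ Finset.range t, ρ ^ (t + q - s) * θ s) := by
              rw [mul_left_comm, mul_add, Finset.mul_sum, ← pow_add, add_comm q t]
              congr 2
              refine Finset.sum_congr rfl fun s hs => ?_
              have := Finset.mem_range.1 hs
              rw [← mul_assoc, ← pow_add]
              congr 2
              omega
      have h3 : C * ∑ r ∈ Finset.range q, θ (t + r)
          ≤ c * ∑ r ∈ Finset.range q, ρ ^ (t + q - (t + r)) * θ (t + r) := by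
        rw [Finset.mul_sum, Finset.mul_sum]
        refine Finset.sum_le_sum fun r _ => ?_
        rw [← mul_assoc]
        refine mul_le_mul_left (hcC.trans (mul_le_mul_right ?_ c)) _
        exact pow_le_pow_right_of_le_one' hρ (by omega)
      refine (hrec t).trans ((add_le_add h2 h3).trans_eq ?_)
      rw [← mul_add, add_assoc, Finset.sum_range_add]

/-- Exchange the sums and group by the lag `i = t - s`: a lag `i ≤ h` contributes `ρ ^ i` times the
tail of `θ` from `h - i`. A lag beyond `h` contributes `ρ ^ i` times the full sum of `θ`; together
these are at most a geometric series times the term `i = h`, which is present because `1 ≤ h`. -/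
theorem tsum_geometric_convolution_le (θ : ℕ → ℝ≥0∞) {ρ : ℝ≥0∞} {h : ℕ} (hh : 1 ≤ h) :
    ∑' k : ℕ, (ρ ^ (h + k) + ∑ s ∈ Finset.range (h + k), ρ ^ (h + k - s) * θ s)
      ≤ (1 + (1 - ρ)⁻¹) * (ρ ^ h + ∑ i ∈ Finset.Icc 1 h, ρ ^ i * ∑' k, θ (h - i + k)) := by
  set Θ : ℕ → ℝ≥0∞ := fun m => ∑' k, θ (m + k) with hΘ
  set S := ∑ i ∈ Finset.Icc 1 h, ρ ^ i * Θ (h - i) with hS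
  have hgeo : ∑' k : ℕ, ρ ^ (h + k) = (1 - ρ)⁻¹ * ρ ^ h := by
    simp only [pow_add]
    rw [ENNReal.tsum_mul_left, ENNReal.tsum_geometric, mul_comm]
  have hinner : ∀ j : ℕ, (∑' k, if j < h + k then ρ ^ (j + 1) * θ (h + k - 1 - j) else 0)
      ≤ ρ ^ (j + 1) * Θ (h - (j + 1)) := by
    intro j
    have e : ∀ k, (if j < h + k then ρ ^ (j + 1) * θ (h + k - 1 - j) else 0)
        = ρ ^ (j + 1) * if j < h + k then θ (h + k - 1 - j) else 0 := by
      intro k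
      split_ifs <;> simp
    simp only [e]
    rw [ENNReal.tsum_mul_left]
    refine mul_le_mul_right ?_ _
    rcases lt_or_ge j h with hj | hj
    · refine ENNReal.tsum_le_tsum fun k => ?_
      rw [if_pos (show j < h + k by omega), show h + k - 1 - j = h - (j + 1) + k by omega]
    -- Here `h - (j + 1)` truncates to `0`: the first `j + 1 - h` terms vanish and the others form
    -- the whole series of `θ`.
    · have hsplit := Summable.sum_add_tsum_nat_add' (k := j + 1 - h)
        (f := fun k => if j < h + k then θ (h + k - 1 - j) else 0) ENNReal.summable
      rw [← hsplit, Finset.sum_eq_zero, zero_add]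
      · refine ENNReal.tsum_le_tsum fun k => ?_
        rw [if_pos (show j < h + (k + (j + 1 - h)) by omega)]
        exact le_of_eq (congrArg θ (by omega))
      · intro k hk
        rw [if_neg]
        have := Finset.mem_range.1 hk
        omega
  have hconv : ∑' k : ℕ, ∑ s ∈ Finset.range (h + k), ρ ^ (h + k - s) * θ s
      ≤ ∑' j : ℕ, ρ ^ (j + 1) * Θ (h - (j + 1)) := by
    have e : ∀ k, ∑ s ∈ Finset.range (h + k), ρ ^ (h + k - s) * θ s
        = ∑' j, if j < h + k then ρ ^ (j + 1) * θ (h + k - 1 - j) else 0 := by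
      intro k
      -- Reflection turns the summation index `s` into `j`, the lag minus one.
      rw [← Finset.sum_range_reflect, tsum_eq_sum (s := Finset.range (h + k))]
      · refine Finset.sum_congr rfl fun j hj => ?_
        have := Finset.mem_range.1 hj
        rw [if_pos this, show h + k - (h + k - 1 - j) = j + 1 by omega]
      · intro j hj
        rw [if_neg (by simpa using hj)]
    simp only [e]
    rw [ENNReal.tsum_comm]
    exact ENNReal.tsum_le_tsum hinner
  have hhead : ∑ j ∈ Finset.range h, ρ ^ (j + 1) * Θ (h - (j + 1)) = S := by
    rw [hS, ← Finset.sum_image (f := fun i => ρ ^ i * Θ (h - i)) (g := fun j => j + 1)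
      (fun a _ b _ hab => by simpa using hab)]
    congr 1
    ext i
    simp only [Finset.mem_image, Finset.mem_range, Finset.mem_Icc]
    constructor
    · rintro ⟨j, hj, rfl⟩
      omega
    · rintro ⟨h1, h2⟩
      exact ⟨i - 1, by omega, by omega⟩
  have htail : ∑' j : ℕ, ρ ^ (j + h + 1) * Θ (h - (j + h + 1)) ≤ (1 - ρ)⁻¹ * S := by
    have h0 : ρ ^ h * Θ 0 ≤ S := by
      have := Finset.single_le_sum (f := fun i => ρ ^ i * Θ (h - i)) (fun _ _ => zero_le)
        (Finset.mem_Icc.2 ⟨hh, le_rfl⟩)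
      simpa using this
    have e : ∀ j : ℕ, ρ ^ (j + h + 1) * Θ (h - (j + h + 1)) = ρ ^ (j + 1) * (ρ ^ h * Θ 0) := by
      intro j
      rw [show h - (j + h + 1) = 0 by omega, ← mul_assoc, ← pow_add]
      congr 2
      omega
    simp only [e]
    rw [ENNReal.tsum_mul_right, ← ENNReal.tsum_geometric]
    refine mul_le_mul' ?_ h0
    exact ENNReal.tsum_comp_le_tsum_of_injective (add_left_injective 1) fun n => ρ ^ n
  rw [ENNReal.tsum_add, hgeo]
  calc (1 - ρ)⁻¹ * ρ ^ h + ∑' k : ℕ, ∑ s ∈ Finset.range (h + k), ρ ^ (h + k - s) * θ s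
      ≤ (1 - ρ)⁻¹ * ρ ^ h + (S + (1 - ρ)⁻¹ * S) := by
        refine add_le_add le_rfl (hconv.trans ?_)
        have hsplit := Summable.sum_add_tsum_nat_add' (k := h)
          (f := fun j => ρ ^ (j + 1) * Θ (h - (j + 1))) ENNReal.summable
        rw [← hsplit, hhead]
        exact add_le_add le_rfl htail
    _ ≤ (ρ ^ h + (1 - ρ)⁻¹ * ρ ^ h) + (S + (1 - ρ)⁻¹ * S) := add_le_add le_add_self le_rfl
    _ = (1 + (1 - ρ)⁻¹) * (ρ ^ h + S) := by ring

/-! ### Resampling one coordinate of an i.i.d. sequence -/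

section Resampling

variable {Ω G : Type*} [MeasurableSpace Ω] [MeasurableSpace G] {P : Measure Ω}
  {ξ : ℤ → Ω → G}

theorem pathLaw_eq_infinitePi (hm : ∀ t, Measurable (ξ t)) (hind : iIndepFun ξ P)
    (hid : ∀ t, IdentDistrib (ξ t) (ξ 0) P P) :
    P.map (fun ω s => ξ s ω) = Measure.infinitePi fun _ : ℤ => P.map (ξ 0) := by
  rw [hind.map_fun_eq_infinitePi_map hm]
  congr 1
  funext t
  exact (hid t).map_eq

theorem measurable_update_path (hm : ∀ t, Measurable (ξ t)) :
    Measurable fun p : Ω × G => Function.update (fun s => ξ s p.1) 0 p.2 := by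
  refine measurable_pi_lambda _ fun s => ?_
  by_cases hs : s = 0
  · subst hs
    simpa using measurable_snd
  · simpa [Function.update_of_ne hs, Function.comp_def] using (hm s).comp measurable_fst

/-- Replacing one coordinate of an i.i.d. sequence by an independent copy does not change the
law of the sequence. -/
theorem map_update_eq_infinitePi [IsProbabilityMeasure P] (hm : ∀ t, Measurable (ξ t)) (hind : iIndepFun ξ P)
    (hid : ∀ t, IdentDistrib (ξ t) (ξ 0) P P) :
    (P.prod (P.map (ξ 0))).map (fun p => Function.update (fun s => ξ s p.1) 0 p.2)
      = Measure.infinitePi fun _ : ℤ => P.map (ξ 0) := by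
  have : IsProbabilityMeasure (P.map (ξ 0)) := Measure.isProbabilityMeasure_map (hm 0).aemeasurable
  refine Measure.eq_infinitePi _ fun s A hA => ?_
  rw [Measure.map_apply (measurable_update_path hm)
    (MeasurableSet.pi s.countable_toSet fun i _ => hA i)]
  have hX : ∀ i, P (ξ i ⁻¹' A i) = P.map (ξ 0) (A i) := by
    intro i
    rw [← Measure.map_apply (hm i) (hA i), (hid i).map_eq]
  have hprod : ∀ T : Finset ℤ, P (⋂ i ∈ T, ξ i ⁻¹' A i) = ∏ i ∈ T, P.map (ξ 0) (A i) := by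
    intro T
    rw [hind.measure_inter_preimage_eq_mul T fun i _ => hA i]
    exact Finset.prod_congr rfl fun i _ => hX i
  -- In a box, the side at time `0` constrains only the copy and the other sides only `ω`, so the
  -- preimage is a rectangle.
  have hset : (fun p : Ω × G => Function.update (fun s => ξ s p.1) 0 p.2) ⁻¹' Set.pi s A
      = (⋂ i ∈ s.erase 0, ξ i ⁻¹' A i) ×ˢ (if 0 ∈ s then A 0 else Set.univ) := by
    ext p
    simp only [Set.mem_preimage, Set.mem_pi, Set.mem_prod, Set.mem_iInter, Finset.mem_erase,
      Finset.mem_coe]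
    constructor
    · intro h
      refine ⟨fun i hi => by simpa [Function.update_of_ne hi.1] using h i hi.2, ?_⟩
      split_ifs with h0
      · simpa using h 0 h0
      · trivial
    · rintro ⟨h1, h2⟩ i hi
      by_cases h0 : i = 0
      · subst h0
        simpa [hi] using h2
      · simpa [Function.update_of_ne h0] using h1 i ⟨h0, hi⟩
  rw [hset, Measure.prod_prod, hprod]
  split_ifs with h0
  · rw [mul_comm, Finset.mul_prod_erase s (fun i => P.map (ξ 0) (A i)) h0]
  · rw [measure_univ, mul_one, Finset.erase_eq_of_notMem h0]

theorem indepFun_past (hm : ∀ t, Measurable (ξ t)) (hind : iIndepFun ξ P) (t : ℤ) :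
    IndepFun (ξ (t + 1)) (fun ω => past (fun s => ξ s ω) t) P := by
  have h := indep_iSup_of_disjoint (fun i => (hm i).comap_le) hind
    (S := {t + 1}) (T := Set.Iic t) (by simp)
  rw [IndepFun_iff_Indep]
  refine indep_of_indep_of_le_left (indep_of_indep_of_le_right h ?_) ?_
  · rw [← measurable_iff_comap_le]
    refine @measurable_pi_lambda Ω ℕ (fun _ => G) (_) _ _ fun j => ?_
    refine measurable_iff_comap_le.2 ?_
    exact le_iSup₂ (f := fun i (_ : i ∈ Set.Iic t) => MeasurableSpace.comap (ξ i) inferInstance)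
      (t - j) (by simp)
  · exact le_iSup₂ (f := fun i (_ : i ∈ ({t + 1} : Set ℤ)) =>
      MeasurableSpace.comap (ξ i) inferInstance) (t + 1) rfl

/-- Independence persists if an independent coordinate is adjoined to one of the variables. -/
theorem indepFun_prodMk_snd [IsProbabilityMeasure P] {A B : Type*} [MeasurableSpace A] [MeasurableSpace B] {X : Ω → A}
    {W : Ω → B} {ν : Measure G} [IsProbabilityMeasure ν] (hX : Measurable X) (hW : Measurable W)
    (h : IndepFun X W P) :
    IndepFun (fun p : Ω × G => X p.1) (fun p : Ω × G => (W p.1, p.2)) (P.prod ν) := by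
  rw [indepFun_iff_measure_inter_preimage_eq_mul]
  intro a b ha hb
  have hX' : Measurable fun p : Ω × G => X p.1 := hX.comp measurable_fst
  have hW' : Measurable fun p : Ω × G => (W p.1, p.2) :=
    (hW.comp measurable_fst).prodMk measurable_snd
  rw [Measure.prod_apply_symm ((hX' ha).inter (hW' hb)), Measure.prod_apply_symm (hW' hb)]
  have e : (fun p : Ω × G => X p.1) ⁻¹' a = (X ⁻¹' a) ×ˢ Set.univ := by
    ext p
    simp
  rw [e, Measure.prod_prod, measure_univ, mul_one, ← lintegral_const_mul _
    (measurable_measure_prodMk_right (hW' hb))]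
  refine lintegral_congr fun y => ?_
  have hb' : MeasurableSet {w : B | (w, y) ∈ b} := measurable_prodMk_right hb
  have := h.measure_inter_preimage_eq_mul a {w | (w, y) ∈ b} ha hb'
  refine Eq.trans (congrArg P ?_) this
  ext ω
  simp

end Resampling

/-! ### Solutions driven by the same noise along two covariate paths -/

theorem volume_mem_uIoc_le (a b : ℝ) :
    (volume : Measure unitInterval) {u | (u : ℝ) ∈ Set.uIoc a b} ≤ ENNReal.ofReal |b - a| := by
  have hs : MeasurableSet (unitInterval : Set ℝ) := measurableSet_Icc
  change volume ((Subtype.val : unitInterval → ℝ) ⁻¹' Set.uIoc a b) ≤ _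
  rw [← volume_image_subtype_coe hs]
  exact (measure_mono (Set.image_preimage_subset _ _)).trans_eq Real.volume_uIoc

section Mismatch

variable {V : Type*} {𝒵 : Set V} {q N : ℕ} {K : 𝒵 → Kernel (Fin q → Fin N) (Fin N)}
  [∀ z, IsMarkovKernel (K z)]

/-- Under the Lipschitz condition, the quantiles of `K_z(· | y)` and `K_{z'}(· | y)` agree for all
`y` outside a set of levels whose measure is a multiple of the distance of `z` and `z'`. -/
theorem volume_exists_quantile_ne_le [NormedAddCommGroup V] {C : ℝ} (hC : 0 ≤ C)
    (hL : ∀ (z z' : 𝒵) (y : Fin q → Fin N),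
      ∑ i : Fin N, |(K z y).real {i} - (K z' y).real {i}| ≤ C * ‖(z : V) - (z' : V)‖)
    (z z' : 𝒵) :
    (volume : Measure unitInterval)
        {u | ∃ y : Fin q → Fin N, quantile (K z y) u ≠ quantile (K z' y) u}
      ≤ (Fintype.card (Fin q → Fin N) * N : ℕ) * ENNReal.ofReal C * edist z z' := by
  have hsub : {u : unitInterval | ∃ y : Fin q → Fin N, quantile (K z y) u ≠ quantile (K z' y) u}
      ⊆ ⋃ y : Fin q → Fin N, ⋃ i : Fin N,
        {u | (u : ℝ) ∈ Set.uIoc (∑ j ∈ Finset.Iic i, (K z y).real {j})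
          (∑ j ∈ Finset.Iic i, (K z' y).real {j})} := by
    rintro u ⟨y, hy⟩
    obtain ⟨i, hi⟩ := exists_mem_uIoc_of_quantile_ne _ _ u hy
    exact Set.mem_iUnion.2 ⟨y, Set.mem_iUnion.2 ⟨i, hi⟩⟩
  have hedist : ENNReal.ofReal (C * ‖(z : V) - (z' : V)‖) = ENNReal.ofReal C * edist z z' := by
    rw [ENNReal.ofReal_mul hC, Subtype.edist_eq, edist_dist, dist_eq_norm]
  have hone : ∀ (y : Fin q → Fin N) (i : Fin N), (volume : Measure unitInterval)
      {u | (u : ℝ) ∈ Set.uIoc (∑ j ∈ Finset.Iic i, (K z y).real {j})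
          (∑ j ∈ Finset.Iic i, (K z' y).real {j})} ≤ ENNReal.ofReal C * edist z z' := by
    intro y i
    refine (volume_mem_uIoc_le _ _).trans ?_
    rw [← hedist]
    refine ENNReal.ofReal_le_ofReal ?_
    rw [abs_sub_comm, ← Finset.sum_sub_distrib]
    refine (Finset.abs_sum_le_sum_abs _ _).trans (le_trans ?_ (hL z z' y))
    exact Finset.sum_le_sum_of_subset_of_nonneg (Finset.subset_univ _) fun _ _ _ => abs_nonneg _
  calc (volume : Measure unitInterval) _
      ≤ ∑ y : Fin q → Fin N, ∑ i : Fin N, (volume : Measure unitInterval)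
        {u | (u : ℝ) ∈ Set.uIoc (∑ j ∈ Finset.Iic i, (K z y).real {j})
          (∑ j ∈ Finset.Iic i, (K z' y).real {j})} :=
        (measure_mono hsub).trans ((measure_iUnion_fintype_le _ _).trans
          (Finset.sum_le_sum fun y _ => measure_iUnion_fintype_le _ _))
    _ ≤ ∑ y : Fin q → Fin N, ∑ i : Fin N, ENNReal.ofReal C * edist z z' :=
        Finset.sum_le_sum fun y _ => Finset.sum_le_sum fun i _ => hone y i
    _ = _ := by
        simp only [Finset.sum_const, Finset.card_univ, Fintype.card_fin, nsmul_eq_mul]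
        push_cast
        ring

end Mismatch

/-- Two paths of covariates and noise, adapted to a filtration, whose noise after time `0` is
the same, uniform and independent of the past. -/
structure NoiseCoupling {Ω Z : Type*} [MeasurableSpace Z] {m0 : MeasurableSpace Ω} (Q : Measure Ω)
    (x x' : Ω → ℤ → Z × unitInterval) (ℱ : ℕ → MeasurableSpace Ω) : Prop where
  mono : Monotone ℱ
  le : ∀ t, ℱ t ≤ m0
  adapted : ∀ (t : ℕ) (s : ℤ), s ≤ t → Measurable[ℱ t] fun ω => x ω s
  adapted' : ∀ (t : ℕ) (s : ℤ), s ≤ t → Measurable[ℱ t] fun ω => x' ω s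
  noise_eq : ∀ (t : ℕ) ω, (x' ω (t + 1)).2 = (x ω (t + 1)).2
  uniform : ∀ t : ℕ, Q.map (fun ω => (x ω (t + 1)).2) = volume
  indep : ∀ t : ℕ, Indep (MeasurableSpace.comap (fun ω => (x ω (t + 1)).2) inferInstance) (ℱ t) Q

/-! ### Contraction of the probability of disagreement under a coupling. -/

namespace NoiseCoupling

section Basic

variable {Ω Z : Type*} [MeasurableSpace Z] {m0 : MeasurableSpace Ω} {Q : Measure Ω}
  {x x' : Ω → ℤ → Z × unitInterval} {ℱ : ℕ → MeasurableSpace Ω}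

theorem measurable_noise (h : NoiseCoupling Q x x' ℱ) (t : ℕ) :
    Measurable fun ω => (x ω (t + 1)).2 :=
  measurable_snd.comp ((h.adapted (t + 1) (t + 1) (by push_cast; rfl)).mono (h.le _) le_rfl)

/-- The probability that the noise stays below `κ` during `k` steps, independently of the past. -/
theorem measure_inter_noise_le (h : NoiseCoupling Q x x' ℱ) {κ : ℝ} (h0 : 0 ≤ κ) (h1 : κ ≤ 1)
    {t : ℕ} {B : Set Ω} (hB : MeasurableSet[ℱ t] B) (k : ℕ) :
    MeasurableSet[ℱ (t + k)] (B ∩ {ω | ∀ r < k, ((x ω ((t + r : ℕ) + 1)).2 : ℝ) ≤ κ}) ∧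
    Q (B ∩ {ω | ∀ r < k, ((x ω ((t + r : ℕ) + 1)).2 : ℝ) ≤ κ}) = ENNReal.ofReal κ ^ k * Q B := by
  induction k with
  | zero => simpa using hB
  | succ k ih =>
    have hset : B ∩ {ω | ∀ r < k + 1, ((x ω ((t + r : ℕ) + 1)).2 : ℝ) ≤ κ}
        = (B ∩ {ω | ∀ r < k, ((x ω ((t + r : ℕ) + 1)).2 : ℝ) ≤ κ})
          ∩ {ω | ((x ω ((t + k : ℕ) + 1)).2 : ℝ) ≤ κ} := by
      ext ω
      simp only [Set.mem_inter_iff, Set.mem_ofPred_eq, Nat.lt_succ_iff_lt_or_eq]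
      constructor
      · rintro ⟨hb, hr⟩
        exact ⟨⟨hb, fun r hrk => hr r (Or.inl hrk)⟩, hr k (Or.inr rfl)⟩
      · rintro ⟨⟨hb, hr⟩, hk⟩
        refine ⟨hb, fun r hrk => ?_⟩
        rcases hrk with hrk | rfl
        · exact hr r hrk
        · exact hk
    rw [hset]
    refine ⟨?_, ?_⟩
    · refine MeasurableSet.inter (h.mono (by omega) _ ih.1) ?_
      exact measurableSet_le (measurable_subtype_coe.comp (measurable_snd.comp
        (h.adapted (t + (k + 1)) ((t + k : ℕ) + 1) (by push_cast; omega)))) measurable_const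
    · rw [measure_inter_le_of_indep (h.measurable_noise (t + k)) (h.uniform (t + k))
        (h.indep (t + k)) ih.1 h0 h1, ih.2, pow_succ]
      ring

end Basic

section Contraction

variable {Ω V : Type*} {m0 : MeasurableSpace Ω} {Q : Measure Ω} [MeasurableSpace V]
  {𝒵 : Set V} {q N : ℕ} {K : 𝒵 → Kernel (Fin q → Fin N) (Fin N)} [∀ z, IsMarkovKernel (K z)]
  {x x' : Ω → ℤ → 𝒵 × unitInterval} {ℱ : ℕ → MeasurableSpace Ω}

/-- The two covariates at time `t` are `ℱ t`-measurable, hence independent of the next noise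
variable, and Fubini reduces the claim to fixed `z` and `z'`. Taking all `y` at once removes any
dependence on the states of the solutions. -/
theorem measure_exists_quantile_ne_le [NormedAddCommGroup V] [BorelSpace V]
    [SecondCountableTopology V] [IsProbabilityMeasure Q]
    (hK : ∀ (y : Fin q → Fin N) (i : Fin N), Measurable fun z => K z y {i})
    (h : NoiseCoupling Q x x' ℱ) {C : ℝ} (hC : 0 ≤ C)
    (hL : ∀ (z z' : 𝒵) (y : Fin q → Fin N),
      ∑ i : Fin N, |(K z y).real {i} - (K z' y).real {i}| ≤ C * ‖(z : V) - (z' : V)‖) (t : ℕ) :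
    Q {ω | ∃ y : Fin q → Fin N, quantile (K (x ω t).1 y) (x ω (t + 1)).2
        ≠ quantile (K (x' ω t).1 y) (x ω (t + 1)).2}
      ≤ (Fintype.card (Fin q → Fin N) * N : ℕ) * ENNReal.ofReal C
        * ∫⁻ ω, edist (x ω t).1 (x' ω t).1 ∂Q := by
  set W : Ω → 𝒵 × 𝒵 := fun ω => ((x ω t).1, (x' ω t).1) with hW
  set U : Ω → unitInterval := fun ω => (x ω (t + 1)).2 with hU
  have hWm' : Measurable[ℱ t] W := by
    exact (measurable_fst.comp (h.adapted t t le_rfl)).prodMk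
      (measurable_fst.comp (h.adapted' t t le_rfl))
  have hWm : Measurable W := hWm'.mono (h.le t) le_rfl
  have hUm : Measurable U := h.measurable_noise t
  have hind : IndepFun W U Q := by
    rw [IndepFun_iff_Indep]
    exact (indep_of_indep_of_le_right (h.indep t) (measurable_iff_comap_le.1 hWm')).symm
  have hjoint : Q.map (fun ω => (W ω, U ω)) = (Q.map W).prod volume := by
    rw [(indepFun_iff_map_prod_eq_prod_map_map hWm.aemeasurable hUm.aemeasurable).1 hind,
      h.uniform t]
  have hM : MeasurableSet {p : (𝒵 × 𝒵) × unitInterval |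
      ∃ y : Fin q → Fin N, quantile (K p.1.1 y) p.2 ≠ quantile (K p.1.2 y) p.2} := by
    simp only [Set.ofPred_exists]
    refine MeasurableSet.iUnion fun y => MeasurableSet.compl (measurableSet_eq_fun ?_ ?_)
    · exact measurable_quantile hK (measurable_fst.comp measurable_fst) measurable_snd
        measurable_const
    · exact measurable_quantile hK (measurable_snd.comp measurable_fst) measurable_snd
        measurable_const
  have hprob : IsProbabilityMeasure (Q.map W) :=
    Measure.isProbabilityMeasure_map hWm.aemeasurable
  calc Q _ = Q.map (fun ω => (W ω, U ω)) {p : (𝒵 × 𝒵) × unitInterval |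
        ∃ y : Fin q → Fin N, quantile (K p.1.1 y) p.2 ≠ quantile (K p.1.2 y) p.2} := by
        rw [Measure.map_apply (hWm.prodMk hUm) hM]
        rfl
    _ ≤ ∫⁻ w : 𝒵 × 𝒵, (Fintype.card (Fin q → Fin N) * N : ℕ) * ENNReal.ofReal C
        * edist w.1 w.2 ∂(Q.map W) := by
        rw [hjoint, Measure.prod_apply hM]
        exact lintegral_mono fun w => volume_exists_quantile_ne_le hC hL w.1 w.2
    _ = _ := by
        have he : Measurable fun w : 𝒵 × 𝒵 => edist w.1 w.2 := measurable_edist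
        rw [lintegral_const_mul _ he, lintegral_map he hWm]

variable [NeZero N]

/-- By causality the path may be frozen at time `t`; every coordinate of the frozen path is
`m`-measurable. -/
theorem measurable_solution_of_le
    (hK : ∀ (y : Fin q → Fin N) (i : Fin N), Measurable fun z => K z y {i})
    {m : MeasurableSpace Ω} {t : ℤ} (hx : ∀ s ≤ t, Measurable[m] fun ω => x ω s) {s : ℤ}
    (hs : s ≤ t) : Measurable[m] fun ω => solution K (x ω) s := by
  have e : (fun ω => solution K (x ω) s) = fun ω => solution K (fun r => x ω (min r t)) s := by
    funext ω
    exact solution_congr K fun r hr => by rw [min_eq_left (hr.trans hs)]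
  rw [e]
  refine (measurable_pi_apply s).comp ((measurable_solution hK).comp ?_)
  exact measurable_pi_lambda _ fun r => hx _ (min_le_right _ _)

/-- The probability that the solutions along the two paths disagree within the last `q` steps
contracts, up to the distance of the covariates. -/
theorem measure_exists_solution_ne_le [NormedAddCommGroup V] [BorelSpace V]
    [SecondCountableTopology V] [IsProbabilityMeasure Q]
    (hK : ∀ (y : Fin q → Fin N) (i : Fin N), Measurable fun z => K z y {i})
    (h : NoiseCoupling Q x x' ℱ) {C : ℝ} (hC : 0 ≤ C)
    (hL : ∀ (z z' : 𝒵) (y : Fin q → Fin N),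
      ∑ i : Fin N, |(K z y).real {i} - (K z' y).real {i}| ≤ C * ‖(z : V) - (z' : V)‖)
    {κ : ℝ} (h0 : 0 ≤ κ) (h1 : κ ≤ 1) (hκ : ∀ z, κ ≤ minMass K z)
    (hx : ∀ᵐ ω ∂Q, x ω ∈ recurrentPaths K) (hx' : ∀ᵐ ω ∂Q, x' ω ∈ recurrentPaths K) (t : ℕ) :
    Q {ω | ∃ s : ℤ, ((t + q : ℕ) : ℤ) - q < s ∧ s ≤ (t + q : ℕ) ∧
        solution K (x ω) s ≠ solution K (x' ω) s}
      ≤ (1 - ENNReal.ofReal κ ^ q) * Q {ω | ∃ s : ℤ, (t : ℤ) - q < s ∧ s ≤ t ∧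
          solution K (x ω) s ≠ solution K (x' ω) s}
        + (Fintype.card (Fin q → Fin N) * N : ℕ) * ENNReal.ofReal C
          * ∑ r ∈ Finset.range q, ∫⁻ ω, edist (x ω (t + r : ℕ)).1 (x' ω (t + r : ℕ)).1 ∂Q := by
  set B := {ω | ∃ s : ℤ, (t : ℤ) - q < s ∧ s ≤ t ∧
    solution K (x ω) s ≠ solution K (x' ω) s} with hBdef
  set S := {ω | ∀ r < q, ((x ω ((t + r : ℕ) + 1)).2 : ℝ) ≤ κ} with hSdef
  set M : ℕ → Set Ω := fun t => {ω | ∃ y : Fin q → Fin N,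
    quantile (K (x ω t).1 y) (x ω (t + 1)).2 ≠ quantile (K (x' ω t).1 y) (x ω (t + 1)).2}
    with hMdef
  have hB : MeasurableSet[ℱ t] B := by
    simp only [hBdef, Set.ofPred_exists, Set.ofPred_and]
    refine MeasurableSet.iUnion fun s => ?_
    by_cases hs : s ≤ t
    · refine MeasurableSet.inter (MeasurableSet.const _) (MeasurableSet.inter
        (MeasurableSet.const _) (MeasurableSet.compl (measurableSet_eq_fun ?_ ?_)))
      · exact measurable_solution_of_le hK (h.adapted t) hs
      · exact measurable_solution_of_le hK (h.adapted' t) hs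
    · simp [hs]
  -- A disagreement in the new window requires either an earlier disagreement without `q` small
  -- noise values, or a mismatch of quantile functions in one of the `q` steps. Otherwise, small
  -- noise puts both solutions in the first category, or the agreement of the old windows propagates
  -- step by step.
  have hsub : ∀ ω, x ω ∈ recurrentPaths K → x' ω ∈ recurrentPaths K →
      (∃ s : ℤ, ((t + q : ℕ) : ℤ) - q < s ∧ s ≤ (t + q : ℕ) ∧
        solution K (x ω) s ≠ solution K (x' ω) s) →
      ω ∈ (B \ (B ∩ S)) ∪ ⋃ r ∈ Finset.range q, M (t + r) := by
    intro ω hω hω' hne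
    by_contra hc
    have hMn : ∀ r < q, ω ∉ M (t + r) := by
      intro r hr hmem
      exact hc (Or.inr (Set.mem_biUnion (Finset.mem_coe.2 (Finset.mem_range.2 hr)) hmem))
    have hBS : ω ∉ B ∨ ω ∈ S := by
      by_contra! hcc
      exact hc (Or.inl ⟨hcc.1, fun hh => hcc.2 hh.2⟩)
    have hY := fun s => congrFun (sweep_solution hω) s
    have hY' := fun s => congrFun (sweep_solution hω') s
    simp only [sweep] at hY hY'
    have hstep : ∀ r < q, solution K (x ω) ((t + r : ℕ) + 1) = solution K (x' ω) ((t + r : ℕ) + 1) := by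
      rcases hBS with hnB | hS
      · have hagree : ∀ k : ℕ, k ≤ q → ∀ s : ℤ, (t : ℤ) - q < s → s ≤ (t + k : ℕ) →
            solution K (x ω) s = solution K (x' ω) s := by
          intro k
          induction k with
          | zero =>
            intro _ s hs1 hs2
            by_contra hcc
            exact hnB ⟨s, hs1, by simpa using hs2, hcc⟩
          | succ k ih =>
            intro hk s hs1 hs2
            rcases lt_or_ge ((t + k : ℕ) : ℤ) s with hlt | hge
            · obtain rfl : s = ((t + k : ℕ) : ℤ) + 1 := by push_cast at hs2 hlt ⊢; omega
              have e : (fun j : Fin q =>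
                    solution K (x ω) (((t + k : ℕ) : ℤ) - ((j : ℕ) : ℤ)))
                  = fun j : Fin q =>
                    solution K (x' ω) (((t + k : ℕ) : ℤ) - ((j : ℕ) : ℤ)) := by
                funext j
                have := j.2
                exact ih (by omega) _ (by push_cast; omega) (by omega)
              have hm := hMn k (by omega)
              simp only [hMdef, Set.mem_ofPred_eq, not_exists, not_not] at hm
              rw [← hY, ← hY', h.noise_eq]
              simp only [add_sub_cancel_right, e]
              exact hm _
            · exact ih (by omega) s hs1 hge
        intro r hr
        exact hagree (r + 1) (by omega) _ (by push_cast; omega) (by push_cast; omega)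
      · intro r hr
        rw [← hY, ← hY', quantile_eq_zero K _ _ _ ((hS r hr).trans (hκ _)), quantile_eq_zero]
        rw [h.noise_eq]
        exact (hS r hr).trans (hκ _)
    obtain ⟨s, hs1, hs2, hs⟩ := hne
    apply hs
    have := hstep (s - 1 - t).toNat (by push_cast at hs1 hs2; omega)
    rwa [show ((t + (s - 1 - t).toNat : ℕ) : ℤ) + 1 = s by push_cast at hs1 hs2 ⊢; omega] at this
  have hBSm := h.measure_inter_noise_le h0 h1 hB q
  -- `B` belongs to `ℱ t` and `S` concerns only later noise, so `B ∩ S` has probability `κ ^ q`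
  -- times that of `B`.
  have hdiff : Q (B \ (B ∩ S)) = (1 - ENNReal.ofReal κ ^ q) * Q B := by
    rw [measure_sdiff Set.inter_subset_left ((h.le _ _ hBSm.1).nullMeasurableSet)
      (measure_ne_top _ _), hBSm.2, ENNReal.sub_mul fun _ _ => measure_ne_top _ _, one_mul]
  calc Q _ ≤ Q ((B \ (B ∩ S)) ∪ ⋃ r ∈ Finset.range q, M (t + r)) := by
        refine measure_mono_ae ?_
        filter_upwards [hx, hx'] with ω hω hω' hne
        exact hsub ω hω hω' hne
    _ ≤ Q (B \ (B ∩ S)) + ∑ r ∈ Finset.range q, Q (M (t + r)) :=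
        (measure_union_le _ _).trans (add_le_add le_rfl (measure_biUnion_finset_le _ _))
    _ ≤ _ := by
        rw [hdiff, Finset.mul_sum]
        refine add_le_add le_rfl (Finset.sum_le_sum fun r _ => ?_)
        exact h.measure_exists_quantile_ne_le hK hC hL (t + r)

end Contraction

end NoiseCoupling

/-! ### Solutions driven by an i.i.d. sequence -/

section Driven

variable {V G : Type*} {𝒵 : Set V}

/-- The path of covariates and noise driven by the sequence of innovations `x`. -/
def drivenPath (H' : (ℕ → G) → 𝒵) (x : ℤ → unitInterval × G) : ℤ → 𝒵 × unitInterval :=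
  fun s => (H' (past (fun r => (x r).2) s), (x s).1)

section Past

variable {q N : ℕ} [NeZero N] (K : 𝒵 → Kernel (Fin q → Fin N) (Fin N))
  [∀ z, IsMarkovKernel (K z)]

/-- The solution at the present time as a function of the past of the innovations. -/
def pastSolution (H' : (ℕ → G) → 𝒵) (w : ℕ → unitInterval × G) : Fin N :=
  solution K (drivenPath H' fun s => w (-s).toNat) 0

/-- Translation moves time `t` to `0`. The sequence built from the past repeats its latest value at
positive times, which causality makes irrelevant. -/
theorem pastSolution_past (H' : (ℕ → G) → 𝒵) (x : ℤ → unitInterval × G) (t : ℤ) :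
    pastSolution K H' (past x t) = solution K (drivenPath H' x) t := by
  have h := solution_translate K (drivenPath H' x) t 0
  rw [zero_add] at h
  rw [← h, pastSolution]
  refine solution_congr K fun s hs => ?_
  have e : ∀ r ≤ (0 : ℤ), past x t (-r).toNat = x (r + t) := by
    intro r hr
    simp only [past]
    congr 1
    omega
  simp only [drivenPath, e s hs]
  congr 2
  funext j
  simp only [past]
  have := e (s - j) (by omega)
  simp only [past] at this
  rw [this]
  congr 2
  ring

end Past

variable [MeasurableSpace V] [MeasurableSpace G] {H' : (ℕ → G) → 𝒵}

theorem measurable_drivenPath_of_le (hH' : Measurable H') {Ω : Type*} {m : MeasurableSpace Ω}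
    {y : Ω → ℤ → unitInterval × G} {t : ℤ} (hy : ∀ r ≤ t, Measurable[m] fun ω => y ω r) {s : ℤ}
    (hs : s ≤ t) : Measurable[m] fun ω => drivenPath H' (y ω) s := by
  refine Measurable.prodMk (hH'.comp (measurable_pi_lambda _ fun j => ?_))
    (measurable_fst.comp (hy s hs))
  exact measurable_snd.comp (hy (s - j) (by omega))

theorem measurable_drivenPath (hH' : Measurable H') : Measurable (drivenPath H') :=
  measurable_pi_lambda _ fun _ =>
    measurable_drivenPath_of_le hH' (fun r _ => measurable_pi_apply r) le_rfl

theorem measurable_pastSolution {q N : ℕ} [NeZero N]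
    {K : 𝒵 → Kernel (Fin q → Fin N) (Fin N)} [∀ z, IsMarkovKernel (K z)] (hH' : Measurable H')
    (hK : ∀ (y : Fin q → Fin N) (i : Fin N), Measurable fun z => K z y {i}) :
    Measurable (pastSolution K H') :=
  (measurable_pi_apply 0).comp ((measurable_solution hK).comp ((measurable_drivenPath hH').comp
    (measurable_pi_lambda _ fun _ => measurable_pi_apply _)))

end Driven

theorem edist_label_le {N : ℕ} (i j : Fin N) : edist (label i) (label j) ≤ N := by
  rw [edist_dist, Real.dist_eq, ← ENNReal.ofReal_natCast]
  refine ENNReal.ofReal_le_ofReal ?_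
  have hi : ((i : ℕ) : ℝ) ≤ N := by exact_mod_cast i.2.le
  have hj : ((j : ℕ) : ℝ) ≤ N := by exact_mod_cast j.2.le
  have hi0 : (0 : ℝ) ≤ ((i : ℕ) : ℝ) := Nat.cast_nonneg _
  have hj0 : (0 : ℝ) ≤ ((j : ℕ) : ℝ) := Nat.cast_nonneg _
  rw [abs_le]
  constructor <;> simp only [label] <;> linarith

/-! ### Resampled innovations and the bound on the dependence coefficients. -/

section ShiftCovariate

variable {Ω V G : Type*} [MeasurableSpace Ω] {P : Measure Ω} [MeasurableSpace V]
  [MeasurableSpace G] {𝒵 : Set V} {Z : ℤ → Ω → 𝒵} {ε : ℤ → Ω → unitInterval} {η : ℤ → Ω → G}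
  {H' : (ℕ → G) → 𝒵}

theorem CovariateNoise.measurable_noise (h : CovariateNoise P Z ε) (t : ℤ) : Measurable (ε t) :=
  measurable_snd.comp (h.ergodic.measurable t)

theorem ShiftCovariate.ae_eq_drivenPath (h : ShiftCovariate P Z ε η H') :
    ∀ᵐ ω ∂P, (fun t => (Z t ω, ε t ω)) = drivenPath H' fun s => (ε s ω, η s ω) := by
  filter_upwards [ae_all_iff.2 h.shift.eq] with ω hω
  funext t
  exact Prod.ext (hω t) rfl

theorem ShiftCovariate.measurable_pair (hC2 : CovariateNoise P Z ε)
    (h : ShiftCovariate P Z ε η H') (t : ℤ) : Measurable fun ω => (ε t ω, η t ω) :=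
  (hC2.measurable_noise t).prodMk (h.measurable t)

/-- The covariates with and without resampling of the innovation at time `0` form a coupling. -/
theorem ShiftCovariate.noiseCoupling [IsProbabilityMeasure P] (hC2 : CovariateNoise P Z ε)
    (h : ShiftCovariate P Z ε η H') :
    NoiseCoupling (P.prod (P.map fun ω => (ε 0 ω, η 0 ω)))
      (fun p => drivenPath H' fun s => (ε s p.1, η s p.1))
      (fun p => drivenPath H' (Function.update (fun s => (ε s p.1, η s p.1)) 0 p.2))
      (fun t => MeasurableSpace.comap
        (fun p : Ω × (unitInterval × G) => (past (fun s => (ε s p.1, η s p.1)) t, p.2))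
        inferInstance) := by
  have hm := h.measurable_pair hC2
  have : IsProbabilityMeasure (P.map fun ω => (ε 0 ω, η 0 ω)) :=
    Measure.isProbabilityMeasure_map (hm 0).aemeasurable
  have hpm : ∀ t : ℕ, Measurable fun p : Ω × (unitInterval × G) =>
      (past (fun s => (ε s p.1, η s p.1)) t, p.2) := fun _ =>
    (measurable_pi_lambda _ fun j => (hm _).comp measurable_fst).prodMk measurable_snd
  -- The copy is included from the start because the resampled path uses it at time `0`; being an
  -- independent coordinate, it leaves the later innovations independent of `ℱ t`.
  set ℱ : ℕ → MeasurableSpace (Ω × (unitInterval × G)) := fun t => MeasurableSpace.comap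
    (fun p : Ω × (unitInterval × G) => (past (fun s => (ε s p.1, η s p.1)) t, p.2)) inferInstance
    with hℱ
  have hcomap : ∀ t : ℕ, Measurable[ℱ t] fun p : Ω × (unitInterval × G) =>
      (past (fun s => (ε s p.1, η s p.1)) t, p.2) := fun t => comap_measurable _
  have hcoord : ∀ (t : ℕ) (s : ℤ), s ≤ t →
      Measurable[ℱ t] fun p : Ω × (unitInterval × G) => (ε s p.1, η s p.1) := by
    intro t s hs
    have h1 := (measurable_pi_apply (t - s).toNat).comp (measurable_fst.comp (hcomap t))
    have e : s = t - (t - s).toNat := by omega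
    rw [e]
    exact h1
  have hcopy : ∀ t : ℕ, Measurable[ℱ t] fun p : Ω × (unitInterval × G) => p.2 := fun t =>
    (measurable_snd (α := ℕ → unitInterval × G) (β := unitInterval × G)).comp (hcomap t)
  refine ⟨?_, fun t => (hpm t).comap_le, ?_, ?_, ?_, ?_, ?_⟩
  · intro t t' htt
    refine measurable_iff_comap_le.1 (Measurable.prodMk ?_ (hcopy t'))
    exact @measurable_pi_lambda _ ℕ (fun _ => unitInterval × G) (ℱ t') _ _ fun j =>
      hcoord t' (t - j) (by omega)
  · intro t s hs
    exact measurable_drivenPath_of_le h.shift.measurable (hcoord t) hs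
  · intro t s hs
    refine measurable_drivenPath_of_le h.shift.measurable (t := t) (fun r hr => ?_) hs
    by_cases h0 : r = 0
    · subst h0
      simpa using hcopy t
    · simpa [Function.update_of_ne h0] using hcoord t r hr
  · intro t p
    -- Only the innovation at time `0` is resampled, so the noise at the times `t + 1 ≥ 1` is
    -- unchanged.
    have h0 : (t : ℤ) + 1 ≠ 0 := by omega
    simp only [drivenPath, Function.update_of_ne h0]
  · intro t
    have e : (fun p : Ω × (unitInterval × G) =>
        (drivenPath H' (fun s => (ε s p.1, η s p.1)) (t + 1)).2) = ε (t + 1) ∘ Prod.fst := rfl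
    rw [e, ← Measure.map_map (hC2.measurable_noise _) measurable_fst, Measure.map_fst_prod,
      measure_univ, one_smul, hC2.uniform]
  · intro t
    have h1 := indepFun_prodMk_snd (ν := P.map fun ω => (ε 0 ω, η 0 ω)) (hm (t + 1))
      (measurable_pi_lambda _ fun j => hm _) (indepFun_past hm h.indep t)
    exact (IndepFun_iff_Indep _ _ _).1 (h1.comp measurable_fst measurable_id)

/-- The copy replaces the whole pair `(ε 0, η 0)`, but the covariates see only its second component,
which has the law of `η 0`. -/
theorem ShiftCovariate.lintegral_edist_eq_theta [EDist 𝒵] [IsProbabilityMeasure P]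
    (hC2 : CovariateNoise P Z ε) (h : ShiftCovariate P Z ε η H')
    (he : Measurable fun w : 𝒵 × 𝒵 => edist w.1 w.2) (t : ℕ) :
    ∫⁻ p : Ω × (unitInterval × G), edist (drivenPath H' (fun s => (ε s p.1, η s p.1)) t).1
      (drivenPath H' (Function.update (fun s => (ε s p.1, η s p.1)) 0 p.2) t).1
      ∂(P.prod (P.map fun ω => (ε 0 ω, η 0 ω))) = theta P η H' t := by
  have hm := h.measurable_pair hC2
  have hν : IsProbabilityMeasure (P.map fun ω => (ε 0 ω, η 0 ω)) :=
    Measure.isProbabilityMeasure_map (hm 0).aemeasurable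
  have hlaw : P.prod (P.map (η 0)) = (P.prod (P.map fun ω => (ε 0 ω, η 0 ω))).map
      (Prod.map id Prod.snd) := by
    rw [← Measure.map_prod_map _ _ measurable_id measurable_snd, Measure.map_id,
      Measure.map_map measurable_snd (hm 0)]
    rfl
  have hpast : ∀ t : ℤ, Measurable fun x : ℤ → G => past x t := fun _ =>
    measurable_pi_lambda _ fun j => measurable_pi_apply _
  have hf : Measurable fun p : Ω × G => edist (H' (past (fun s => η s p.1) t))
      (H' (past (Function.update (fun s => η s p.1) 0 p.2) t)) := by
    refine he.comp (Measurable.prodMk ?_ ?_)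
    · exact h.shift.measurable.comp ((hpast t).comp
        (measurable_pi_lambda _ fun s => (h.measurable s).comp measurable_fst))
    · exact h.shift.measurable.comp ((hpast t).comp (measurable_update_path h.measurable))
  rw [theta, hlaw, lintegral_map hf (measurable_id.prodMap measurable_snd)]
  refine lintegral_congr fun p => ?_
  have e : (fun r => (Function.update (fun s => (ε s p.1, η s p.1)) 0 p.2 r).2)
      = Function.update (fun s => η s p.1) 0 p.2.2 := by
    funext r
    by_cases h0 : r = 0
    · subst h0
      simp
    · simp [Function.update_of_ne h0]
  simp only [drivenPath, e]
  rfl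

variable {q N : ℕ} [NeZero N] {K : 𝒵 → Kernel (Fin q → Fin N) (Fin N)}
  [∀ z, IsMarkovKernel (K z)] {Y : ℤ → Ω → Fin N}

theorem ShiftCovariate.ae_eq_solution (h : ShiftCovariate P Z ε η H')
    (hG : ∀ᵐ ω ∂P, (fun t => (Z t ω, ε t ω)) ∈ recurrentPaths K) (hY : IsSolution P K Z ε Y) :
    ∀ᵐ ω ∂P, (fun t => Y t ω) = solution K (drivenPath H' fun s => (ε s ω, η s ω)) := by
  filter_upwards [hY.ae_eq_solution hG, h.ae_eq_drivenPath] with ω h1 h2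
  rw [h1, h2]

theorem ShiftCovariate.isBernoulliShift_pastSolution (h : ShiftCovariate P Z ε η H')
    (hK : ∀ (y : Fin q → Fin N) (i : Fin N), Measurable fun z => K z y {i})
    (hG : ∀ᵐ ω ∂P, (fun t => (Z t ω, ε t ω)) ∈ recurrentPaths K) (hY : IsSolution P K Z ε Y) :
    IsBernoulliShift P (fun t ω => (ε t ω, η t ω)) (pastSolution K H') Y := by
  refine ⟨measurable_pastSolution h.shift.measurable hK, fun t => ?_⟩
  filter_upwards [h.ae_eq_solution hG hY] with ω hω
  rw [pastSolution_past]
  exact congrFun hω t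

/-- The coefficients of any representation of the solution are controlled by the probability that
the solutions with and without resampling differ. -/
theorem ShiftCovariate.theta_le [IsProbabilityMeasure P] (hC2 : CovariateNoise P Z ε)
    (h : ShiftCovariate P Z ε η H')
    (hK : ∀ (y : Fin q → Fin N) (i : Fin N), Measurable fun z => K z y {i})
    (hG : ∀ᵐ ω ∂P, (fun t => (Z t ω, ε t ω)) ∈ recurrentPaths K) (hY : IsSolution P K Z ε Y)
    {H : (ℕ → unitInterval × G) → Fin N}
    (hH : IsBernoulliShift P (fun t ω => (ε t ω, η t ω)) H Y) (t : ℕ) :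
    theta P (fun t ω => (ε t ω, η t ω)) (fun x => label (H x)) t
      ≤ N * P.prod (P.map fun ω => (ε 0 ω, η 0 ω)) {p |
        solution K (drivenPath H' fun s => (ε s p.1, η s p.1)) t ≠
        solution K (drivenPath H' (Function.update (fun s => (ε s p.1, η s p.1)) 0 p.2)) t} := by
  have hm := h.measurable_pair hC2
  have hν : IsProbabilityMeasure (P.map fun ω => (ε 0 ω, η 0 ω)) :=
    Measure.isProbabilityMeasure_map (hm 0).aemeasurable
  have hξ : Measurable fun ω => fun s => (ε s ω, η s ω) := measurable_pi_lambda _ hm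
  have hset : MeasurableSet {x : ℤ → unitInterval × G |
      H (past x t) = solution K (drivenPath H' x) t} := by
    refine measurableSet_eq_fun (hH.measurable.comp (measurable_pi_lambda _ fun j =>
      measurable_pi_apply _)) ?_
    exact (measurable_pi_apply (t : ℤ)).comp
      ((measurable_solution hK).comp (measurable_drivenPath h.shift.measurable))
  have hP : ∀ᵐ ω ∂P, H (past (fun s => (ε s ω, η s ω)) t)
      = solution K (drivenPath H' fun s => (ε s ω, η s ω)) t := by
    filter_upwards [h.ae_eq_solution hG hY, hH.eq t] with ω h1 h2
    rw [← h2, ← h1]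
  -- An arbitrary `H` agrees with the pathwise solution almost everywhere for the law of the
  -- innovations. The resampled sequence has the same law, so `H` can be replaced on both sides of
  -- the distance.
  have hlaw : ∀ᵐ x ∂(Measure.infinitePi fun _ : ℤ => P.map fun ω => (ε 0 ω, η 0 ω)),
      H (past x t) = solution K (drivenPath H' x) t := by
    rw [← pathLaw_eq_infinitePi hm h.indep h.identDistrib]
    exact (ae_map_iff hξ.aemeasurable hset).2 hP
  have h1 : ∀ᵐ p ∂(P.prod (P.map fun ω => (ε 0 ω, η 0 ω))),
      H (past (fun s => (ε s p.1, η s p.1)) t)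
        = solution K (drivenPath H' fun s => (ε s p.1, η s p.1)) t :=
    Measure.quasiMeasurePreserving_fst.ae hP
  have h2 : ∀ᵐ p ∂(P.prod (P.map fun ω => (ε 0 ω, η 0 ω))),
      H (past (Function.update (fun s => (ε s p.1, η s p.1)) 0 p.2) t)
        = solution K (drivenPath H'
          (Function.update (fun s => (ε s p.1, η s p.1)) 0 p.2)) t := by
    rw [← map_update_eq_infinitePi hm h.indep h.identDistrib] at hlaw
    exact ae_of_ae_map (measurable_update_path hm).aemeasurable hlaw
  set A := {p : Ω × (unitInterval × G) |
        solution K (drivenPath H' fun s => (ε s p.1, η s p.1)) t ≠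
        solution K (drivenPath H' (Function.update (fun s => (ε s p.1, η s p.1)) 0 p.2)) t}
  refine le_trans (lintegral_mono_ae ?_) (lintegral_indicator_const_le A (N : ℝ≥0∞))
  filter_upwards [h1, h2] with p hp1 hp2
  rw [hp1, hp2]
  by_cases hp : p ∈ A
  · rw [Set.indicator_of_mem hp]
    exact edist_label_le _ _
  · have hp' : solution K (drivenPath H' fun s => (ε s p.1, η s p.1)) t
        = solution K (drivenPath H'
          (Function.update (fun s => (ε s p.1, η s p.1)) 0 p.2)) t := not_not.1 hp
    rw [hp', edist_self]
    exact zero_le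

theorem ShiftCovariate.exists_bigTheta_le [IsProbabilityMeasure P] [NormedAddCommGroup V]
    [BorelSpace V] [SecondCountableTopology V] (hC2 : CovariateNoise P Z ε)
    (h : ShiftCovariate P Z ε η H') (hq : 1 ≤ q)
    (hK : ∀ (y : Fin q → Fin N) (i : Fin N), Measurable fun z => K z y {i})
    (hG : ∀ᵐ ω ∂P, (fun t => (Z t ω, ε t ω)) ∈ recurrentPaths K) (hL : KernelsLipschitz K)
    (hκ : 0 < ⨅ z, minMass K z) (hY : IsSolution P K Z ε Y) :
    ∃ C ρ : ℝ, 0 < C ∧ 0 < ρ ∧ ρ < 1 ∧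
      ∀ H : (ℕ → unitInterval × G) → Fin N,
        IsBernoulliShift P (fun t ω => (ε t ω, η t ω)) H Y →
        ∀ h : ℕ, 1 ≤ h →
          bigTheta P (fun t ω => (ε t ω, η t ω)) (fun x => label (H x)) h ≤
            ENNReal.ofReal C * (ENNReal.ofReal ρ ^ h +
              ∑ i ∈ Finset.Icc 1 h, ENNReal.ofReal ρ ^ i * bigTheta P η H' (h - i)) := by
  obtain ⟨C₀, hC₀, hL⟩ := hL
  set κ := ⨅ z, minMass K z with hκdef
  have hκle : ∀ z, κ ≤ minMass K z := fun z =>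
    ciInf_le ⟨0, by rintro _ ⟨z, rfl⟩; exact minMass_nonneg K z⟩ z
  have hm := h.measurable_pair hC2
  have hν : IsProbabilityMeasure (P.map fun ω => (ε 0 ω, η 0 ω)) :=
    Measure.isProbabilityMeasure_map (hm 0).aemeasurable
  -- A sample point supplies an element of `𝒵`, without which `κ ≤ 1` could not be read off a
  -- kernel.
  obtain ⟨ω₀⟩ : Nonempty Ω := P.nonempty_of_neZero
  have hκ1 : κ ≤ 1 := (hκle (Z 0 ω₀)).trans ((minMass_le K _ 0 fun _ => 0).trans measureReal_le_one)
  have hκq0 : 0 < κ ^ q := pow_pos hκ q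
  have hκq1 : κ ^ q ≤ 1 := pow_le_one₀ hκ.le hκ1
  -- The contraction factor is `1 - κ ^ q`; halving `κ ^ q` keeps `δ`, and so `ρ`, positive even if
  -- `κ = 1`.
  set δ : ℝ := 1 - κ ^ q / 2 with hδ
  have hδ0 : 0 < δ := by rw [hδ]; linarith
  have hδ1 : δ < 1 := by rw [hδ]; linarith
  set ρ : ℝ := δ ^ ((q : ℝ)⁻¹) with hρ
  have hρ0 : 0 < ρ := Real.rpow_pos_of_pos hδ0 _
  have hρ1 : ρ < 1 := Real.rpow_lt_one hδ0.le hδ1 (by positivity)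
  have hρq : ρ ^ q = δ := Real.rpow_inv_natCast_pow hδ0.le (by omega)
  set A : ℝ := (Fintype.card (Fin q → Fin N) * N : ℕ) * C₀ with hA
  have hA0 : 0 ≤ A := by positivity
  -- Chosen so that `c * ρ ^ q = 1 + A` dominates both `1` and `A`, as the recursive inequality
  -- requires.
  set c : ℝ := (1 + A) / δ with hc
  have hc0 : 0 < c := by positivity
  have hcρ : ENNReal.ofReal c * ENNReal.ofReal ρ ^ q = ENNReal.ofReal (1 + A) := by
    rw [← ENNReal.ofReal_pow hρ0.le, ← ENNReal.ofReal_mul hc0.le, hρq, hc,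
      div_mul_cancel₀ _ hδ0.ne']
  have hN : (0 : ℝ) < N := by exact_mod_cast NeZero.pos N
  have hρ' : 0 < 1 - ρ := by linarith
  have hconst : ENNReal.ofReal (N * c * (1 + (1 - ρ)⁻¹))
      = N * (ENNReal.ofReal c * (1 + (1 - ENNReal.ofReal ρ)⁻¹)) := by
    rw [mul_assoc, ENNReal.ofReal_mul hN.le, ENNReal.ofReal_natCast, ENNReal.ofReal_mul hc0.le,
      ENNReal.ofReal_add zero_le_one (by positivity), ENNReal.ofReal_one,
      ENNReal.ofReal_inv_of_pos hρ', ENNReal.ofReal_sub 1 hρ0.le, ENNReal.ofReal_one]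
  set Q := P.prod (P.map fun ω => (ε 0 ω, η 0 ω)) with hQ
  set x : Ω × (unitInterval × G) → ℤ → 𝒵 × unitInterval :=
    fun p => drivenPath H' fun s => (ε s p.1, η s p.1) with hx
  set x' : Ω × (unitInterval × G) → ℤ → 𝒵 × unitInterval :=
    fun p => drivenPath H' (Function.update (fun s => (ε s p.1, η s p.1)) 0 p.2) with hx'
  have hP : ∀ᵐ ω ∂P, drivenPath H' (fun s => (ε s ω, η s ω)) ∈ recurrentPaths K := by
    filter_upwards [hG, h.ae_eq_drivenPath] with ω h1 h2
    rwa [← h2]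
  have hxG : ∀ᵐ p ∂Q, x p ∈ recurrentPaths K := Measure.quasiMeasurePreserving_fst.ae hP
  have hxG' : ∀ᵐ p ∂Q, x' p ∈ recurrentPaths K := by
    have hset : MeasurableSet {y : ℤ → unitInterval × G | drivenPath H' y ∈ recurrentPaths K} :=
      measurable_drivenPath h.shift.measurable (measurableSet_recurrentPaths hK)
    have hlaw := (ae_map_iff (measurable_pi_lambda _ hm).aemeasurable hset).2 hP
    rw [pathLaw_eq_infinitePi hm h.indep h.identDistrib,
      ← map_update_eq_infinitePi hm h.indep h.identDistrib] at hlaw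
    exact ae_of_ae_map (measurable_update_path hm).aemeasurable hlaw
  set p : ℕ → ℝ≥0∞ := fun t => Q {w | ∃ s : ℤ, (t : ℤ) - q < s ∧ s ≤ t ∧
    solution K (x w) s ≠ solution K (x' w) s} with hp
  have hrec : ∀ t, p (t + q) ≤ ENNReal.ofReal ρ ^ q * p t
      + ENNReal.ofReal A * ∑ r ∈ Finset.range q, theta P η H' (t + r) := by
    intro t
    have h1 := (h.noiseCoupling hC2).measure_exists_solution_ne_le hK hC₀.le hL hκ.le hκ1 hκle
      hxG hxG' t
    simp only [h.lintegral_edist_eq_theta hC2 measurable_edist] at h1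
    refine h1.trans (add_le_add (mul_le_mul_left ?_ _) (mul_le_mul_left (le_of_eq ?_) _))
    · rw [← ENNReal.ofReal_pow hρ0.le, hρq, ← ENNReal.ofReal_pow hκ.le, ← ENNReal.ofReal_one,
        ← ENNReal.ofReal_sub 1 hκq0.le]
      exact ENNReal.ofReal_le_ofReal (by rw [hδ]; linarith)
    · rw [hA, ENNReal.ofReal_mul (Nat.cast_nonneg _), ENNReal.ofReal_natCast]
  have hpt := le_of_contractive_recursion (c := ENNReal.ofReal c) hq
    (ENNReal.ofReal_le_one.2 hρ1.le) (fun t => prob_le_one) hrec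
    (by rw [hcρ, ENNReal.one_le_ofReal]; linarith)
    (by rw [hcρ]; exact ENNReal.ofReal_le_ofReal (by linarith))
  refine ⟨N * c * (1 + (1 - ρ)⁻¹), ρ, by positivity, hρ0, hρ1, fun H hH n hn => ?_⟩
  have hθ : ∀ t : ℕ, theta P (fun t ω => (ε t ω, η t ω)) (fun x => label (H x)) t
      ≤ N * (ENNReal.ofReal c * (ENNReal.ofReal ρ ^ t
        + ∑ s ∈ Finset.range t, ENNReal.ofReal ρ ^ (t - s) * theta P η H' s)) := by
    intro t
    refine (h.theta_le hC2 hK hG hY hH t).trans (mul_le_mul_right (le_trans ?_ (hpt t)) _)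
    -- The time `t` itself lies in the window `(t - q, t]` because `1 ≤ q`.
    exact measure_mono fun w hw => ⟨t, by omega, le_rfl, hw⟩
  calc bigTheta P (fun t ω => (ε t ω, η t ω)) (fun x => label (H x)) n
      ≤ ∑' k : ℕ, N * (ENNReal.ofReal c * (ENNReal.ofReal ρ ^ (n + k)
        + ∑ s ∈ Finset.range (n + k), ENNReal.ofReal ρ ^ (n + k - s) * theta P η H' s)) :=
        ENNReal.tsum_le_tsum fun k => hθ (n + k)
    _ ≤ _ := by
        rw [ENNReal.tsum_mul_left, ENNReal.tsum_mul_left, hconst, mul_assoc, mul_assoc]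
        exact mul_le_mul_right (mul_le_mul_right (tsum_geometric_convolution_le _ hn) _) _

end ShiftCovariate

end

end CatSeries

open CatSeries

theorem mainTheorem11
    {Ω : Type*} [MeasurableSpace Ω] (P : Measure Ω) [IsProbabilityMeasure P]
    {V : Type*} [NormedAddCommGroup V] [NormedSpace ℝ V] [FiniteDimensional ℝ V]
    [MeasurableSpace V] [BorelSpace V] (𝒵 : Set V) (h𝒵 : MeasurableSet 𝒵)
    (q N : ℕ) (hq : 1 ≤ q) (hN : 1 ≤ N)
    (K : 𝒵 → Kernel (Fin q → Fin N) (Fin N)) [∀ z, IsMarkovKernel (K z)]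
    (hK : ∀ (y : Fin q → Fin N) (i : Fin N), Measurable fun z => K z y {i})
    (Z : ℤ → Ω → 𝒵) (ε : ℤ → Ω → unitInterval)
    (hC1 : KernelsPositive K) (hC2 : CovariateNoise P Z ε) :
    (∃ Y : ℤ → Ω → Fin N,
      IsStationary P Y ∧ IsSolution P K Z ε Y ∧
      IsStationaryErgodic P (fun t ω => (Y t ω, Z t ω)) ∧
      ∀ Y' : ℤ → Ω → Fin N, IsStationary P Y' → IsSolution P K Z ε Y' →
        ∀ t, Y' t =ᵐ[P] Y t) ∧
    (∀ {G₁ : Type*} [MeasurableSpace G₁] (η : ℤ → Ω → G₁) (H' : (ℕ → G₁) → 𝒵),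
      ShiftCovariate P Z ε η H' → KernelsLipschitz K → 0 < ⨅ z, minMass K z →
      ∀ Y : ℤ → Ω → Fin N, IsStationary P Y → IsSolution P K Z ε Y →
        (∃ H : (ℕ → unitInterval × G₁) → Fin N,
          IsBernoulliShift P (fun t ω => (ε t ω, η t ω)) H Y) ∧
        ∃ C ρ : ℝ, 0 < C ∧ 0 < ρ ∧ ρ < 1 ∧
          ∀ H : (ℕ → unitInterval × G₁) → Fin N,
            IsBernoulliShift P (fun t ω => (ε t ω, η t ω)) H Y →
            ∀ h : ℕ, 1 ≤ h →
              bigTheta P (fun t ω => (ε t ω, η t ω)) (fun x => label (H x)) h ≤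
                ENNReal.ofReal C * (ENNReal.ofReal ρ ^ h +
                  ∑ i ∈ Finset.Icc 1 h, ENNReal.ofReal ρ ^ i * bigTheta P η H' (h - i))) := by
  have : NeZero N := ⟨by omega⟩
  refine ⟨exists_unique_stationary_solution hK hC1 hC2, ?_⟩
  intro G₁ _ η H' hA4 hL hκ Y _ hY
  have hG := ae_mem_recurrentPaths hK hC1 hC2
  -- Properness gives second countability, which makes the distance of two covariates jointly
  -- measurable.
  have : ProperSpace V := FiniteDimensional.proper ℝ V
  exact ⟨⟨_, hA4.isBernoulliShift_pastSolution hK hG hY⟩,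
    hA4.exists_bigTheta_le hC2 hq hK hG hL hκ hY⟩
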